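/- Work in classical first-order logic with equality, in the language $\mathcal{L}=\{\in\}$ of set theory; $T\vdash\varphi$ means that $\varphi$ is formally derivable from $T$. Let $\mathbf{M}$ be the theory with the axioms: extensionality, emptyset, pair, union, set difference, powerset, transitive containment ($\forall x\,\exists y\,(y \text{ is transitive} \wedge x\subseteq y)$), infinity, set foundation ($\forall z\,(\exists x\,(x\in z)\Rightarrow \exists y\,(y\in z\wedge(\forall x\in y)\,x\notin z))$), and the scheme of $\Delta_0$-separation, that is, for every $\Delta_0$-formula $\phi(x,\vec z)$, $$\forall\vec z\,\forall w\,\exists y\,\forall x\,(x\in y\iff x\in w\wedge\phi(x,\vec z)).$$ Let $\mathrm{Mac}$ be $\mathbf{M}$ together with the axiom of choice. Let $\Delta_0^{\mathcal P}$ be the smallest class of $\mathcal{L}$-formulae that contains all atomic formulae and is closed under the connectives of first-order logic and under the quantifiers $\forall x\in y$, $\exists x\in y$, $\forall x\subseteq y$, $\exists x\subseteq y$, where $x$ and $y$ are distinct variables. A $\Pi_2^{\mathcal P}$-sentence is a sentence of the form $\forall\vec x\,\exists\vec y\,\theta(\vec x,\vec y)$ with $\theta\in\Delta_0^{\mathcal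 P}$, where $\vec x$ and $\vec y$ are finite, possibly empty, lists of variables. The scheme of $\Delta_0^{\mathcal P}$-collection consists of the sentences $$\forall\vec z\,\forall w\,\bigl((\forall x\in w)\,\exists y\,\phi(x,y,\vec z)\Rightarrow\exists C\,(\forall x\in w)(\exists y\in C)\,\phi(x,y,\vec z)\bigr)$$ for all $\Delta_0^{\mathcal P}$-formulae $\phi(x,y,\vec z)$. **Theorem.** (I) The theory $\mathbf{M}+\Delta_0^{\mathcal P}\text{-collection}$ is $\Pi_2^{\mathcal P}$-conservative over $\mathbf{M}$: for every $\Pi_2^{\mathcal P}$-sentence $\varphi$, $\mathbf{M}+\Delta_0^{\mathcal P}\text{-collection}\vdash\varphi$ if and only if $\mathbf{M}\vdash\varphi$. (II) The theory $\mathrm{Mac}+\Delta_0^{\mathcal P}\text{-collection}$ is $\Pi_2^{\mathcal P}$-conservative over $\mathrm{Mac}$: for every $\Pi_2^{\mathcal P}$-sentence $\varphi$, $\mathrm{Mac}+\Delta_0^{\mathcal P}\text{-collection}\vdash\varphi$ if and only if $\mathrm{Mac}\vdash\varphi$. -/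

import Mathlib

namespace SetTheories

open FirstOrder.Language
open scoped FirstOrder

/-! ## The language of set theory -/

/-- The only non-logical symbol of the language of set theory: a binary relation symbol. -/
inductive MemSymbol : ℕ → Type
  | mem : MemSymbol 2

/-- The language of set theory. It has no function symbols, so every term is a variable. -/
abbrev LSet : FirstOrder.Language.{0, 0} := ⟨fun _ => Empty, MemSymbol⟩

/-- Formulas whose free variables are among `&0, …, &(n - 1)`. The variable bound by a quantifier
in front of a formula with `n + 1` variables is `&n`. -/
abbrev Fml (n : ℕ) := LSet.BoundedFormula Empty n

/-- A class of formulas. -/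
abbrev FmlClass := ∀ n : ℕ, Fml n → Prop

/-- The atomic formula `s ∈ t`. -/
def memF {α : Type} {n : ℕ} (s t : LSet.Term (α ⊕ Fin n)) : LSet.BoundedFormula α n :=
  Relations.boundedFormula₂ (L := LSet) MemSymbol.mem s t

local infix:88 " ∈ₛ " => memF

/-- A variable seen in the scope of one more quantifier. -/
def up {α : Type} {n : ℕ} (x : α ⊕ Fin n) : α ⊕ Fin (n + 1) := Sum.map id Fin.castSucc x

/-- A term seen in the scope of one more quantifier. -/
def upT {α : Type} {n : ℕ} (t : LSet.Term (α ⊕ Fin n)) : LSet.Term (α ⊕ Fin (n + 1)) :=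
  t.relabel up

/-- `s ⊆ t`, that is, `∀ x, x ∈ s → x ∈ t`. -/
def subF {α : Type} {n : ℕ} (s t : LSet.Term (α ⊕ Fin n)) : LSet.BoundedFormula α n :=
  ∀' ((&(Fin.last n) ∈ₛ upT s) ⟹ (&(Fin.last n) ∈ₛ upT t))

local infix:88 " ⊆ₛ " => subF

/-- `(∀ x ∈ t) φ`, where `x` is the variable `&n`. -/
def allMem {n : ℕ} (t : LSet.Term (Empty ⊕ Fin n)) (φ : Fml (n + 1)) : Fml n :=
  ∀' ((&(Fin.last n) ∈ₛ upT t) ⟹ φ)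

/-- `(∃ x ∈ t) φ`, where `x` is the variable `&n`. -/
def exMem {n : ℕ} (t : LSet.Term (Empty ⊕ Fin n)) (φ : Fml (n + 1)) : Fml n :=
  ∃' ((&(Fin.last n) ∈ₛ upT t) ⊓ φ)

/-- `(∀ x ⊆ t) φ`, where `x` is the variable `&n`. -/
def allSub {n : ℕ} (t : LSet.Term (Empty ⊕ Fin n)) (φ : Fml (n + 1)) : Fml n :=
  ∀' ((&(Fin.last n) ⊆ₛ upT t) ⟹ φ)

/-- `(∃ x ⊆ t) φ`, where `x` is the variable `&n`. -/
def exSub {n : ℕ} (t : LSet.Term (Empty ⊕ Fin n)) (φ : Fml (n + 1)) : Fml n :=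
  ∃' ((&(Fin.last n) ⊆ₛ upT t) ⊓ φ)

/-! ## Renaming of variables -/

/-- The extension of a renaming of variables to the scope of a quantifier: the newly bound
variable is sent to the newly bound variable. -/
def liftRen {α β : Type} {n m : ℕ} (σ : α ⊕ Fin n → β ⊕ Fin m) :
    α ⊕ Fin (n + 1) → β ⊕ Fin (m + 1) :=
  Sum.elim (fun a => up (σ (Sum.inl a)))
    (Fin.lastCases (Sum.inr (Fin.last m)) (fun i => up (σ (Sum.inr i))))

/-- Rename the free variables of a formula along `σ`. -/
def rename {α β : Type} : {n m : ℕ} → (α ⊕ Fin n → β ⊕ Fin m) →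
    LSet.BoundedFormula α n → LSet.BoundedFormula β m
  | _, _, _, .falsum => .falsum
  | _, _, σ, .equal s t => .equal (s.relabel σ) (t.relabel σ)
  | _, _, σ, .rel R ts => .rel R (fun i => (ts i).relabel σ)
  | _, _, σ, .imp φ ψ => .imp (rename σ φ) (rename σ ψ)
  | _, _, σ, .all φ => .all (rename (liftRen σ) φ)

/-! ## Provability: natural deduction for classical first-order logic with equality

Derivations are about formulas whose free variables are named by natural numbers. -/

/-- For `φ` with the distinguished variable `&0`, the formula `φ(x)`. -/
def inst (φ : LSet.BoundedFormula ℕ 1) (x : ℕ) : LSet.Formula ℕ :=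
  rename (Sum.elim Sum.inl (fun _ => Sum.inl x)) φ

/-- Replace each free variable `x` by `x + 1`, so that the variable `0` becomes fresh. -/
def shift {n : ℕ} (φ : LSet.BoundedFormula ℕ n) : LSet.BoundedFormula ℕ n :=
  rename (Sum.map Nat.succ id) φ

/-- `Derives Γ φ`: there is a derivation of `φ` from the hypotheses `Γ`. In the rule `allI`, the
variable `0` is the eigenvariable; it does not occur free in the shifted formulas. -/
inductive Derives : Set (LSet.Formula ℕ) → LSet.Formula ℕ → Prop
  | hyp {Γ : Set (LSet.Formula ℕ)} {φ : LSet.Formula ℕ} : φ ∈ Γ → Derives Γ φ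
  | impI {Γ : Set (LSet.Formula ℕ)} {φ ψ : LSet.Formula ℕ} :
      Derives (insert φ Γ) ψ → Derives Γ (φ.imp ψ)
  | impE {Γ : Set (LSet.Formula ℕ)} {φ ψ : LSet.Formula ℕ} :
      Derives Γ (φ.imp ψ) → Derives Γ φ → Derives Γ ψ
  | byContradiction {Γ : Set (LSet.Formula ℕ)} {φ : LSet.Formula ℕ} :
      Derives (insert φ.not Γ) ⊥ → Derives Γ φ
  | allI {Γ : Set (LSet.Formula ℕ)} {φ : LSet.BoundedFormula ℕ 1} :
      Derives (shift '' Γ) (inst (shift φ) 0) → Derives Γ φ.all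
  | allE {Γ : Set (LSet.Formula ℕ)} {φ : LSet.BoundedFormula ℕ 1} (x : ℕ) :
      Derives Γ φ.all → Derives Γ (inst φ x)
  | eqRefl {Γ : Set (LSet.Formula ℕ)} (x : ℕ) :
      Derives Γ (Term.equal (Term.var x) (Term.var x))
  | eqSubst {Γ : Set (LSet.Formula ℕ)} (φ : LSet.BoundedFormula ℕ 1) {x y : ℕ} :
      Derives Γ (Term.equal (Term.var x) (Term.var y)) →
      Derives Γ (inst φ x) → Derives Γ (inst φ y)

/-- A sentence, as a formula of the kind that occurs in derivations. -/
def ofSentence (φ : LSet.Sentence) : LSet.Formula ℕ :=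
  rename (Sum.map Empty.elim id) φ

/-- `T ⊢ φ`. -/
def Proves (T : LSet.Theory) (φ : LSet.Sentence) : Prop :=
  Derives (ofSentence '' T) (ofSentence φ)

/-- `S` is `Γ`-conservative over `T`: `S` and `T` prove the same `Γ`-sentences. -/
def Conservative (Γ : FmlClass) (S T : LSet.Theory) : Prop :=
  ∀ φ : LSet.Sentence, Γ 0 φ → (Proves S φ ↔ Proves T φ)

/-! ## Classes of formulas

In `BoundedFormula`, the connectives `¬, ∧, ∨, ↔` are abbreviations in terms of `→` and `⊥`. -/

/-- The class `Δ₀`. -/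
inductive IsDelta0 : FmlClass
  | atomic {n : ℕ} {φ : Fml n} : φ.IsAtomic → IsDelta0 n φ
  | falsum {n : ℕ} : IsDelta0 n ⊥
  | imp {n : ℕ} {φ ψ : Fml n} : IsDelta0 n φ → IsDelta0 n ψ → IsDelta0 n (φ.imp ψ)
  | allMem {n : ℕ} (t : LSet.Term (Empty ⊕ Fin n)) {φ : Fml (n + 1)} :
      IsDelta0 (n + 1) φ → IsDelta0 n (allMem t φ)
  | exMem {n : ℕ} (t : LSet.Term (Empty ⊕ Fin n)) {φ : Fml (n + 1)} :
      IsDelta0 (n + 1) φ → IsDelta0 n (exMem t φ)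

/-- The class `Δ₀^𝒫`: the least class that contains the atomic formulas and is closed under the
connectives and the quantifiers `∀ x ∈ y`, `∃ x ∈ y`, `∀ x ⊆ y`, `∃ x ⊆ y`. -/
inductive IsDelta0P : FmlClass
  | atomic {n : ℕ} {φ : Fml n} : φ.IsAtomic → IsDelta0P n φ
  | falsum {n : ℕ} : IsDelta0P n ⊥
  | imp {n : ℕ} {φ ψ : Fml n} : IsDelta0P n φ → IsDelta0P n ψ → IsDelta0P n (φ.imp ψ)
  | allMem {n : ℕ} (t : LSet.Term (Empty ⊕ Fin n)) {φ : Fml (n + 1)} :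
      IsDelta0P (n + 1) φ → IsDelta0P n (allMem t φ)
  | exMem {n : ℕ} (t : LSet.Term (Empty ⊕ Fin n)) {φ : Fml (n + 1)} :
      IsDelta0P (n + 1) φ → IsDelta0P n (exMem t φ)
  | allSub {n : ℕ} (t : LSet.Term (Empty ⊕ Fin n)) {φ : Fml (n + 1)} :
      IsDelta0P (n + 1) φ → IsDelta0P n (allSub t φ)
  | exSub {n : ℕ} (t : LSet.Term (Empty ⊕ Fin n)) {φ : Fml (n + 1)} :
      IsDelta0P (n + 1) φ → IsDelta0P n (exSub t φ)

/-- The formulas `∃ x₁ … ∃ xₖ φ` with `φ` in the class `Γ`. -/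
inductive ExBlock (Γ : FmlClass) : FmlClass
  | base {n : ℕ} {φ : Fml n} : Γ n φ → ExBlock Γ n φ
  | ex {n : ℕ} {φ : Fml (n + 1)} : ExBlock Γ (n + 1) φ → ExBlock Γ n φ.ex

/-- The formulas `∀ x₁ … ∀ xₖ φ` with `φ` in the class `Γ`. -/
inductive AllBlock (Γ : FmlClass) : FmlClass
  | base {n : ℕ} {φ : Fml n} : Γ n φ → AllBlock Γ n φ
  | all {n : ℕ} {φ : Fml (n + 1)} : AllBlock Γ (n + 1) φ → AllBlock Γ n φ.all

mutual

/-- The class `Σₖ^𝒫`. -/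
def IsSigmaP : ℕ → FmlClass
  | 0 => IsDelta0P
  | k + 1 => ExBlock (IsPiP k)

/-- The class `Πₖ^𝒫`. -/
def IsPiP : ℕ → FmlClass
  | 0 => IsDelta0P
  | k + 1 => AllBlock (IsSigmaP k)

end

/-! ## Axioms -/

/-- `∀ x y, (∀ u, u ∈ x ↔ u ∈ y) → x = y`. -/
def extensionality : LSet.Sentence :=
  ∀' ∀' ((∀' ((&2 ∈ₛ &0) ⇔ (&2 ∈ₛ &1))) ⟹ (&0 =' &1))

/-- `∃ x, ∀ u, u ∉ x`. -/
def emptySet : LSet.Sentence :=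
  ∃' ∀' ∼(&1 ∈ₛ &0)

/-- `∀ x y, ∃ z, ∀ u, u ∈ z ↔ u = x ∨ u = y`. -/
def pairing : LSet.Sentence :=
  ∀' ∀' ∃' ∀' ((&3 ∈ₛ &2) ⇔ ((&3 =' &0) ⊔ (&3 =' &1)))

/-- `∀ x, ∃ y, ∀ u, u ∈ y ↔ ∃ v, v ∈ x ∧ u ∈ v`. -/
def unionAx : LSet.Sentence :=
  ∀' ∃' ∀' ((&2 ∈ₛ &1) ⇔ ∃' ((&3 ∈ₛ &0) ⊓ (&2 ∈ₛ &3)))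

/-- `∀ x y, ∃ z, ∀ u, u ∈ z ↔ u ∈ x ∧ u ∉ y`. -/
def setDifference : LSet.Sentence :=
  ∀' ∀' ∃' ∀' ((&3 ∈ₛ &2) ⇔ ((&3 ∈ₛ &0) ⊓ ∼(&3 ∈ₛ &1)))

/-- `∀ x, ∃ y, ∀ u, u ∈ y ↔ u ⊆ x`. -/
def powersetAx : LSet.Sentence :=
  ∀' ∃' ∀' ((&2 ∈ₛ &1) ⇔ (&2 ⊆ₛ &0))

/-- Transitive containment: `∀ x, ∃ y, (∀ u, u ∈ y → ∀ v, v ∈ u → v ∈ y) ∧ x ⊆ y`. -/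
def transitiveContainment : LSet.Sentence :=
  ∀' ∃' ((∀' ((&2 ∈ₛ &1) ⟹ ∀' ((&3 ∈ₛ &2) ⟹ (&3 ∈ₛ &1)))) ⊓ (&0 ⊆ₛ &1))

/-- `∃ w, (∃ e, e ∈ w ∧ e = ∅) ∧ ∀ y, y ∈ w → ∃ s, s ∈ w ∧ s = y ∪ {y}`. -/
def infinityAx : LSet.Sentence :=
  ∃' ((∃' ((&1 ∈ₛ &0) ⊓ ∀' ∼(&2 ∈ₛ &1))) ⊓
    ∀' ((&1 ∈ₛ &0) ⟹
      ∃' ((&2 ∈ₛ &0) ⊓ ∀' ((&3 ∈ₛ &2) ⇔ ((&3 ∈ₛ &1) ⊔ (&3 =' &1))))))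

/-- `∀ z, (∃ x, x ∈ z) → ∃ y, y ∈ z ∧ ∀ x, x ∈ y → x ∉ z`. -/
def setFoundation : LSet.Sentence :=
  ∀' ((∃' (&1 ∈ₛ &0)) ⟹ ∃' ((&1 ∈ₛ &0) ⊓ ∀' ((&2 ∈ₛ &1) ⟹ ∼(&2 ∈ₛ &0))))

/-- The axiom of choice: every set `F` of nonempty, pairwise disjoint sets has a transversal `C`,
a set that meets each member of `F` in exactly one element. -/
def choiceAx : LSet.Sentence :=
  ∀' (((∀' ((&1 ∈ₛ &0) ⟹ ∃' (&2 ∈ₛ &1))) ⊓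
      (∀' ∀' (((&1 ∈ₛ &0) ⊓ (&2 ∈ₛ &0)) ⟹
        ((∃' ((&3 ∈ₛ &1) ⊓ (&3 ∈ₛ &2))) ⟹ (&1 =' &2))))) ⟹
    ∃' ∀' ((&2 ∈ₛ &0) ⟹
      ∃' (((&3 ∈ₛ &2) ⊓ (&3 ∈ₛ &1)) ⊓
        ∀' (((&4 ∈ₛ &2) ⊓ (&4 ∈ₛ &1)) ⟹ (&4 =' &3)))))

/-- After the `n` parameters, the `i`-th of `m` further variables. -/
def bv (n m : ℕ) (i : Fin m) : LSet.Term (Empty ⊕ Fin (n + m)) :=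
  &(Fin.natAdd n i)

/-- `φ(z₁, …, zₙ, x)`, where `x` is the `i`-th of `m` variables after the parameters. -/
def app1 {n : ℕ} (m : ℕ) (φ : Fml (n + 1)) (i : Fin m) : Fml (n + m) :=
  rename (Sum.map id (Fin.append (Fin.castAdd m) ![Fin.natAdd n i])) φ

/-- `φ(z₁, …, zₙ, x, y)`, where `x`, `y` are the `i`-th and the `j`-th of `m` variables after the
parameters. -/
def app2 {n : ℕ} (m : ℕ) (φ : Fml (n + 2)) (i j : Fin m) : Fml (n + m) :=
  rename (Sum.map id (Fin.append (Fin.castAdd m) ![Fin.natAdd n i, Fin.natAdd n j])) φ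

/-- `∀ z₁ … zₙ, ∀ w, ∃ y, ∀ x, x ∈ y ↔ x ∈ w ∧ φ(z₁, …, zₙ, x)`. -/
def separationFor {n : ℕ} (φ : Fml (n + 1)) : LSet.Sentence :=
  BoundedFormula.alls (n := n)
    (∀' ∃' ∀' ((bv n 3 2 ∈ₛ bv n 3 1) ⇔ ((bv n 3 2 ∈ₛ bv n 3 0) ⊓ app1 3 φ 2)))

/-- `∀ z₁ … zₙ, ∀ w, (∀ x, x ∈ w → ∃ y, φ(z₁, …, zₙ, x, y)) →
∃ C, ∀ x, x ∈ w → ∃ y, y ∈ C ∧ φ(z₁, …, zₙ, x, y)`. -/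
def collectionFor {n : ℕ} (φ : Fml (n + 2)) : LSet.Sentence :=
  BoundedFormula.alls (n := n)
    (∀' ((∀' ((bv n 2 1 ∈ₛ bv n 2 0) ⟹ ∃' (app2 3 φ 1 2))) ⟹
      ∃' ∀' ((bv n 3 2 ∈ₛ bv n 3 0) ⟹
        ∃' ((bv n 4 3 ∈ₛ bv n 4 1) ⊓ app2 4 φ 2 3))))

/-- The scheme of `Γ`-separation. -/
def separation (Γ : FmlClass) : LSet.Theory :=
  {σ | ∃ (n : ℕ) (φ : Fml (n + 1)), Γ (n + 1) φ ∧ σ = separationFor φ}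

/-- The scheme of `Γ`-collection. -/
def collection (Γ : FmlClass) : LSet.Theory :=
  {σ | ∃ (n : ℕ) (φ : Fml (n + 2)), Γ (n + 2) φ ∧ σ = collectionFor φ}

/-! ## Theories -/

/-- The theory `S₁`. -/
def theoryS1 : LSet.Theory :=
  {extensionality, emptySet, pairing, unionAx, setDifference, powersetAx}

/-- The theory `M`. -/
def theoryM : LSet.Theory :=
  theoryS1 ∪ {transitiveContainment, infinityAx, setFoundation} ∪ separation IsDelta0

/-- The theory `Mac`. -/
def theoryMac : LSet.Theory :=
  theoryM ∪ {choiceAx}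

end SetTheories

namespace SetTheories

open FirstOrder.Language
open scoped FirstOrder

/-! ## Renaming -/

-- By completeness and soundness the problem is one about models. If $T$, which is $\mathbf{M}$ or
-- $\mathrm{Mac}$, does not prove $\forall\vec x\,\exists\vec y\,\theta$, some $N\models T$ has a
-- tuple $\vec a$ with no $\vec y$ satisfying $\theta(\vec a,\vec y)$. It suffices to build a model
-- of $T$ plus collection in which a copy of $\vec a$ is still a counterexample.
--
-- In $N$, start from a transitive set $T_0$ containing $\vec a$ and an inductive set, and put
-- $T_{k+1}=\mathcal P(T_k)$ for every standard $k$. Pass to an ultrapower $N^*$ over a nonprincipal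
-- ultrafilter on $\mathbb N$ and let $K$ consist of the elements of the constant germs $S_k$ of the
-- $T_k$. Then $K$ is closed under elements and subsets, so $\Delta_0^{\mathcal P}$-formulae are
-- absolute between $K$ and $N^*$, and $K$ inherits $\mathbf{M}$ and choice (`IsTower.isModel`,
-- `IsTower.choice`). A $\Sigma_1^{\mathcal P}$-statement about $\vec a$ true in $K$ goes up to
-- $N^*$ and down to $N$ by Łoś's theorem, so the counterexample survives.
--
-- Collection in $K$ is underspill (`IsTower.collection`). The germ of the finite chains
-- $\{T_0,\dots,T_k\}$ is a set $c$ of $N^*$ with members that include every $S_k$. If every $x\in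
-- w$ has a witness in $K$, then each such nonstandard member of $c$ bounds witnesses for all $x\in
-- w$. The members of $c$ with this property form a set by $\Delta_0^{\mathcal P}$-separation, which
-- $\mathbf{M}$ proves (`IsModel.sepP`). An $\in$-minimal one cannot be nonstandard, because the
-- previous member of the chain would also be nonstandard; hence some $S_i\in K$ bounds the
-- witnesses.

@[simp] theorem liftRen_up {α β : Type} {n m : ℕ} (σ : α ⊕ Fin n → β ⊕ Fin m) (x : α ⊕ Fin n) :
    liftRen σ (up x) = up (σ x) := by
  cases x <;> simp [liftRen, up]

@[simp] theorem liftRen_last {α β : Type} {n m : ℕ} (σ : α ⊕ Fin n → β ⊕ Fin m) :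
    liftRen σ (Sum.inr (Fin.last n)) = Sum.inr (Fin.last m) := by
  simp [liftRen]

/-- A function on the variables in the scope of a quantifier is determined by its values on the
old variables and on the new one. -/
theorem ext_up {α γ : Type} {n : ℕ} {f g : α ⊕ Fin (n + 1) → γ} (h : ∀ x, f (up x) = g (up x))
    (hl : f (Sum.inr (Fin.last n)) = g (Sum.inr (Fin.last n))) : f = g := by
  funext x
  rcases x with a | i
  · exact h (Sum.inl a)
  · refine Fin.lastCases hl (fun j => ?_) i
    exact h (Sum.inr j)

theorem liftRen_comp {α β γ : Type} {n m k : ℕ} (τ : β ⊕ Fin m → γ ⊕ Fin k)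
    (σ : α ⊕ Fin n → β ⊕ Fin m) : liftRen τ ∘ liftRen σ = liftRen (τ ∘ σ) :=
  ext_up (by simp) (by simp)

theorem liftRen_map {α β : Type} {n : ℕ} (σ : α → β) :
    liftRen (Sum.map σ (id : Fin n → Fin n)) = Sum.map σ id :=
  ext_up (fun x => by rw [liftRen_up]; cases x <;> rfl) (by simp)

theorem rename_rename {α β γ : Type} {n m k : ℕ} (τ : β ⊕ Fin m → γ ⊕ Fin k)
    (σ : α ⊕ Fin n → β ⊕ Fin m) (φ : LSet.BoundedFormula α n) :
    rename τ (rename σ φ) = rename (τ ∘ σ) φ := by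
  induction φ generalizing m k with
  | falsum => rfl
  | equal s t => simp [rename, Term.relabel_relabel]
  | rel R ts => simp [rename, Term.relabel_relabel]
  | imp φ ψ ih₁ ih₂ => simp [rename, ih₁, ih₂]
  | all φ ih => simp [rename, ih, liftRen_comp]

theorem realize_rename {M : Type} [LSet.Structure M] {α β : Type} {n m : ℕ}
    (σ : α ⊕ Fin n → β ⊕ Fin m) (φ : LSet.BoundedFormula α n) (v : β → M) (xs : Fin m → M) :
    (rename σ φ).Realize v xs ↔
      φ.Realize (fun a => Sum.elim v xs (σ (Sum.inl a)))
        (fun i => Sum.elim v xs (σ (Sum.inr i))) := by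
  induction φ generalizing m with
  | falsum => rfl
  | equal s t =>
    simp only [rename, BoundedFormula.Realize, Term.realize_relabel]
    have : Sum.elim (fun a => Sum.elim v xs (σ (Sum.inl a)))
        (fun i => Sum.elim v xs (σ (Sum.inr i))) = Sum.elim v xs ∘ σ := by
      funext x; cases x <;> rfl
    rw [this]
  | rel R ts =>
    simp only [rename, BoundedFormula.Realize, Term.realize_relabel]
    have : Sum.elim (fun a => Sum.elim v xs (σ (Sum.inl a)))
        (fun i => Sum.elim v xs (σ (Sum.inr i))) = Sum.elim v xs ∘ σ := by
      funext x; cases x <;> rfl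
    rw [this]
  | imp φ ψ ih₁ ih₂ => simp only [rename, BoundedFormula.Realize, ih₁, ih₂]
  | @all n φ ih =>
    simp only [rename, BoundedFormula.Realize, ih]
    refine forall_congr' fun x => ?_
    have hup : ∀ y : β ⊕ Fin m, Sum.elim v (Fin.snoc xs x : Fin (m + 1) → M) (up y) =
        Sum.elim v xs y := by
      rintro (y | y) <;> simp [up]
    have h1 : ∀ a : α, liftRen σ (Sum.inl a) = up (σ (Sum.inl a)) := fun a => rfl
    have h2 : (fun i => Sum.elim v (Fin.snoc xs x : Fin (m + 1) → M) (liftRen σ (Sum.inr i))) =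
        (Fin.snoc (fun i => Sum.elim v xs (σ (Sum.inr i))) x : Fin (n + 1) → M) := by
      funext i
      refine Fin.lastCases ?_ (fun j => ?_) i
      · simp
      · have : liftRen σ (Sum.inr j.castSucc) = up (σ (Sum.inr j)) := liftRen_up σ (Sum.inr j)
        simp [this, hup]
    rw [h2]
    simp only [h1, hup]

/-- Rename the free variables named by natural numbers. -/
def ren (σ : ℕ → ℕ) {n : ℕ} (φ : LSet.BoundedFormula ℕ n) : LSet.BoundedFormula ℕ n :=
  rename (Sum.map σ id) φ

theorem ren_imp (σ : ℕ → ℕ) {n : ℕ} (φ ψ : LSet.BoundedFormula ℕ n) :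
    ren σ (φ.imp ψ) = (ren σ φ).imp (ren σ ψ) := rfl

theorem ren_all (σ : ℕ → ℕ) {n : ℕ} (φ : LSet.BoundedFormula ℕ (n + 1)) :
    ren σ φ.all = (ren σ φ).all := by
  simp [ren, rename, liftRen_map]

theorem ren_ren (σ τ : ℕ → ℕ) {n : ℕ} (φ : LSet.BoundedFormula ℕ n) :
    ren σ (ren τ φ) = ren (σ ∘ τ) φ := by
  rw [ren, ren, rename_rename, ren, Sum.map_comp_map, Function.id_comp]

theorem shift_eq_ren {n : ℕ} (φ : LSet.BoundedFormula ℕ n) : shift φ = ren Nat.succ φ := rfl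

theorem ren_inst (σ : ℕ → ℕ) (φ : LSet.BoundedFormula ℕ 1) (x : ℕ) :
    ren σ (inst φ x) = inst (ren σ φ) (σ x) := by
  rw [ren, inst, inst, ren, rename_rename, rename_rename]
  congr 1
  funext y
  rcases y with y | y <;> rfl

theorem ren_ofSentence (σ : ℕ → ℕ) (φ : LSet.Sentence) : ren σ (ofSentence φ) = ofSentence φ := by
  rw [ren, ofSentence, rename_rename]
  congr 1
  funext y
  rcases y with y | y
  · exact y.elim
  · rfl

theorem realize_inst {M : Type} [LSet.Structure M] (φ : LSet.BoundedFormula ℕ 1) (x : ℕ)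
    (v : ℕ → M) (xs : Fin 0 → M) :
    BoundedFormula.Realize (inst φ x) v xs ↔ φ.Realize v (fun _ => v x) := by
  rw [inst, realize_rename]
  rfl

theorem realize_ren {M : Type} [LSet.Structure M] (σ : ℕ → ℕ) {n : ℕ}
    (φ : LSet.BoundedFormula ℕ n) (v : ℕ → M) (xs : Fin n → M) :
    (ren σ φ).Realize v xs ↔ φ.Realize (v ∘ σ) xs := by
  rw [ren, realize_rename]
  rfl

theorem realize_ofSentence {M : Type} [LSet.Structure M] (φ : LSet.Sentence) (v : ℕ → M)
    (xs : Fin 0 → M) : BoundedFormula.Realize (ofSentence φ) v xs ↔ M ⊨ φ := by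
  rw [ofSentence, realize_rename, Sentence.Realize, Formula.Realize]
  exact iff_of_eq (congrArg₂ _ (Subsingleton.elim _ _) (Subsingleton.elim _ _))

/-! ## Soundness and structural properties of derivations -/

theorem snoc_fin_zero {M : Type} (v : Fin 0 → M) (x : M) :
    (Fin.snoc v x : Fin 1 → M) = fun _ => x := by
  funext i
  obtain rfl : i = Fin.last 0 := Subsingleton.elim (α := Fin 1) _ _
  rw [Fin.snoc_last]

theorem Derives.sound {Γ : Set (LSet.Formula ℕ)} {φ : LSet.Formula ℕ} (h : Derives Γ φ)
    {M : Type} [LSet.Structure M] (v : ℕ → M) (hΓ : ∀ ψ ∈ Γ, ψ.Realize v) : φ.Realize v := by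
  induction h generalizing v with
  | hyp h => exact hΓ _ h
  | impI _ ih =>
    intro hφ
    exact ih v (Set.forall_mem_insert.2 ⟨hφ, hΓ⟩)
  | impE _ _ ih₁ ih₂ => exact ih₁ v hΓ (ih₂ v hΓ)
  | @byContradiction Γ φ _ ih =>
    by_contra hφ
    exact ih v (Set.forall_mem_insert.2 ⟨hφ, hΓ⟩)
  | @allI Γ φ _ ih =>
    intro x
    -- The eigenvariable `0` takes the value `x`; the shifted variables keep their old values.
    have h := ih (fun n => Nat.casesOn n x v) (by
      rintro _ ⟨ψ, hψ, rfl⟩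
      rw [shift_eq_ren]
      exact (realize_ren (M := M) _ _ _ _).2 (hΓ ψ hψ))
    rw [Formula.Realize, realize_inst, shift_eq_ren, realize_ren] at h
    rw [snoc_fin_zero]
    exact h
  | @allE Γ φ x _ ih =>
    have h := ih v hΓ (v x)
    rw [snoc_fin_zero] at h
    exact (realize_inst _ _ _ _).2 h
  | eqRefl x => exact (rfl : v x = v x)
  | @eqSubst Γ φ x y _ _ ih₁ ih₂ =>
    have h₁ : v x = v y := ih₁ v hΓ
    have h₂ := (realize_inst _ _ _ _).1 (ih₂ v hΓ)
    rw [h₁] at h₂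
    exact (realize_inst _ _ _ _).2 h₂

theorem Derives.mono {Γ Δ : Set (LSet.Formula ℕ)} {φ : LSet.Formula ℕ} (h : Derives Γ φ)
    (hΔ : Γ ⊆ Δ) : Derives Δ φ := by
  induction h generalizing Δ with
  | hyp h => exact .hyp (hΔ h)
  | impI _ ih => exact .impI (ih (Set.insert_subset_insert hΔ))
  | impE _ _ ih₁ ih₂ => exact .impE (ih₁ hΔ) (ih₂ hΔ)
  | byContradiction _ ih => exact .byContradiction (ih (Set.insert_subset_insert hΔ))
  | allI _ ih => exact .allI (ih (Set.image_mono hΔ))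
  | allE x _ ih => exact .allE x (ih hΔ)
  | eqRefl x => exact .eqRefl x
  | eqSubst φ _ _ ih₁ ih₂ => exact .eqSubst φ (ih₁ hΔ) (ih₂ hΔ)

theorem Derives.exists_finite {Γ : Set (LSet.Formula ℕ)} {φ : LSet.Formula ℕ}
    (h : Derives Γ φ) : ∃ Δ ⊆ Γ, Δ.Finite ∧ Derives Δ φ := by
  have drop : ∀ {Γ Δ : Set (LSet.Formula ℕ)} {ψ : LSet.Formula ℕ}, Δ ⊆ insert ψ Γ →
      Δ \ {ψ} ⊆ Γ := fun h x hx => (h hx.1).resolve_left hx.2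
  have back : ∀ {Δ : Set (LSet.Formula ℕ)} {ψ : LSet.Formula ℕ}, Δ ⊆ insert ψ (Δ \ {ψ}) := by
    intro Δ ψ x hx
    by_cases h : x = ψ
    · exact Or.inl h
    · exact Or.inr ⟨hx, h⟩
  induction h with
  | @hyp Γ φ h =>
    exact ⟨{φ}, Set.singleton_subset_iff.2 h, Set.finite_singleton _, .hyp rfl⟩
  | impI _ ih =>
    obtain ⟨Δ, hs, hf, hd⟩ := ih
    exact ⟨_, drop hs, hf.sdiff, .impI (hd.mono back)⟩
  | impE _ _ ih₁ ih₂ =>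
    obtain ⟨Δ₁, hs₁, hf₁, hd₁⟩ := ih₁
    obtain ⟨Δ₂, hs₂, hf₂, hd₂⟩ := ih₂
    exact ⟨Δ₁ ∪ Δ₂, Set.union_subset hs₁ hs₂, hf₁.union hf₂,
      .impE (hd₁.mono Set.subset_union_left) (hd₂.mono Set.subset_union_right)⟩
  | byContradiction _ ih =>
    obtain ⟨Δ, hs, hf, hd⟩ := ih
    exact ⟨_, drop hs, hf.sdiff, .byContradiction (hd.mono back)⟩
  | allI _ ih =>
    obtain ⟨Δ, hs, hf, hd⟩ := ih
    obtain ⟨Δ', hs', hf', hd'⟩ := Set.exists_subset_image_finite_and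
      (p := fun Δ => Derives Δ _).1 ⟨Δ, hs, hf, hd⟩
    exact ⟨Δ', hs', hf', .allI hd'⟩
  | allE x _ ih =>
    obtain ⟨Δ, hs, hf, hd⟩ := ih
    exact ⟨Δ, hs, hf, .allE x hd⟩
  | eqRefl x => exact ⟨∅, Set.empty_subset _, Set.finite_empty, .eqRefl x⟩
  | eqSubst φ _ _ ih₁ ih₂ =>
    obtain ⟨Δ₁, hs₁, hf₁, hd₁⟩ := ih₁
    obtain ⟨Δ₂, hs₂, hf₂, hd₂⟩ := ih₂
    exact ⟨Δ₁ ∪ Δ₂, Set.union_subset hs₁ hs₂, hf₁.union hf₂,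
      .eqSubst φ (hd₁.mono Set.subset_union_left) (hd₂.mono Set.subset_union_right)⟩

/-- The renaming need not be injective. This is what lets any fresh variable play the role of the
eigenvariable `0`. -/
theorem Derives.ren {Γ : Set (LSet.Formula ℕ)} {φ : LSet.Formula ℕ} (h : Derives Γ φ)
    (σ : ℕ → ℕ) : Derives (SetTheories.ren σ '' Γ) (SetTheories.ren σ φ) := by
  induction h generalizing σ with
  | hyp h => exact .hyp (Set.mem_image_of_mem _ h)
  | impI _ ih =>
    rw [ren_imp]
    refine .impI ?_
    rw [← Set.image_insert_eq]
    exact ih σ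
  | impE _ _ ih₁ ih₂ => exact .impE (ih₁ σ) (ih₂ σ)
  | byContradiction _ ih =>
    refine .byContradiction ?_
    have := ih σ
    rw [Set.image_insert_eq] at this
    exact this
  | @allI Γ φ _ ih =>
    rw [ren_all]
    refine .allI ?_
    -- Under the eigenvariable, `σ` becomes the renaming that fixes `0` and acts as `σ` on
    -- successors; it commutes with `shift`.
    have h := ih (fun n => Nat.casesOn n 0 (fun k => σ k + 1))
    rw [ren_inst] at h
    have e : ∀ {n : ℕ} (ψ : LSet.BoundedFormula ℕ n),
        SetTheories.ren (fun n => Nat.casesOn n 0 (fun k => σ k + 1)) (shift ψ) =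
          shift (SetTheories.ren σ ψ) := by
      intro n ψ
      rw [shift_eq_ren, shift_eq_ren, ren_ren, ren_ren]
      rfl
    rw [e, Set.image_image] at h
    simp only [e] at h
    rw [Set.image_image]
    exact h
  | @allE Γ φ x _ ih =>
    rw [ren_inst]
    refine .allE _ ?_
    rw [← ren_all]
    exact ih σ
  | eqRefl x => exact .eqRefl (σ x)
  | @eqSubst Γ φ x y _ _ ih₁ ih₂ =>
    have h₂ := ih₂ σ
    rw [ren_inst] at h₂ ⊢
    exact .eqSubst _ (ih₁ σ) h₂

/-! ## Bounds for the free variables of a formula -/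

/-- All free variables of `φ` are less than `N`. -/
def VarsBelow (N : ℕ) {n : ℕ} (φ : LSet.BoundedFormula ℕ n) : Prop :=
  ∀ σ τ : ℕ → ℕ, (∀ x < N, σ x = τ x) → ren σ φ = ren τ φ

theorem VarsBelow.mono {N N' n : ℕ} {φ : LSet.BoundedFormula ℕ n} (h : VarsBelow N φ)
    (hN : N ≤ N') : VarsBelow N' φ :=
  fun σ τ hστ => h σ τ fun x hx => hστ x (hx.trans_le hN)

theorem exists_term_bound {n : ℕ} (t : LSet.Term (ℕ ⊕ Fin n)) :
    ∃ N, ∀ σ τ : ℕ → ℕ, (∀ x < N, σ x = τ x) →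
      t.relabel (Sum.map σ id) = t.relabel (Sum.map τ (id : Fin n → Fin n)) := by
  rcases t with (x | i) | ⟨f, _⟩
  · exact ⟨x + 1, fun σ τ h => by simp [Term.relabel, h x (Nat.lt_succ_self x)]⟩
  · exact ⟨0, fun σ τ _ => rfl⟩
  · exact f.elim

/-- Every formula has a fresh variable. Freshness is expressed through the action of renamings, so
no set of free variables has to be computed. -/
theorem exists_varsBelow {n : ℕ} (φ : LSet.BoundedFormula ℕ n) : ∃ N, VarsBelow N φ := by
  induction φ with
  | falsum => exact ⟨0, fun σ τ _ => rfl⟩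
  | equal s t =>
    obtain ⟨N₁, h₁⟩ := exists_term_bound s
    obtain ⟨N₂, h₂⟩ := exists_term_bound t
    refine ⟨max N₁ N₂, fun σ τ h => ?_⟩
    simp only [ren, rename]
    rw [h₁ σ τ fun x hx => h x (lt_max_of_lt_left hx),
      h₂ σ τ fun x hx => h x (lt_max_of_lt_right hx)]
  | rel R ts =>
    choose N h using fun i => exists_term_bound (ts i)
    refine ⟨Finset.univ.sup N, fun σ τ hστ => ?_⟩
    simp only [ren, rename]
    congr 1
    funext i
    exact h i σ τ fun x hx => hστ x (hx.trans_le (Finset.le_sup (Finset.mem_univ i)))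
  | imp φ ψ ih₁ ih₂ =>
    obtain ⟨N₁, h₁⟩ := ih₁
    obtain ⟨N₂, h₂⟩ := ih₂
    refine ⟨max N₁ N₂, fun σ τ h => ?_⟩
    rw [ren_imp, ren_imp, h₁ σ τ fun x hx => h x (lt_max_of_lt_left hx),
      h₂ σ τ fun x hx => h x (lt_max_of_lt_right hx)]
  | all φ ih =>
    obtain ⟨N, h⟩ := ih
    exact ⟨N, fun σ τ hστ => by rw [ren_all, ren_all, h σ τ hστ]⟩

theorem VarsBelow.inst {N x : ℕ} {φ : LSet.BoundedFormula ℕ 1} (h : VarsBelow N φ) (hx : x < N) :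
    VarsBelow N (SetTheories.inst φ x) := by
  intro σ τ hστ
  rw [ren_inst, ren_inst, h σ τ hστ, hστ x hx]

theorem VarsBelow.imp {N n : ℕ} {φ ψ : LSet.BoundedFormula ℕ n} (h₁ : VarsBelow N φ)
    (h₂ : VarsBelow N ψ) : VarsBelow N (φ.imp ψ) := by
  intro σ τ hστ
  rw [ren_imp, ren_imp, h₁ σ τ hστ, h₂ σ τ hστ]

theorem VarsBelow.all {N n : ℕ} {φ : LSet.BoundedFormula ℕ (n + 1)} (h : VarsBelow N φ) :
    VarsBelow N φ.all := by
  intro σ τ hστ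
  rw [ren_all, ren_all, h σ τ hστ]

/-- Generalization on a variable that is not free in the hypotheses. -/
theorem Derives.generalize {Γ : Set (LSet.Formula ℕ)} {φ : LSet.BoundedFormula ℕ 1} {x : ℕ}
    (hΓ : ∀ ψ ∈ Γ, VarsBelow x ψ) (hφ : VarsBelow x φ) (h : Derives Γ (inst φ x)) :
    Derives Γ φ.all := by
  -- This renaming turns the fresh variable `x` into the eigenvariable `0` and agrees with
  -- `Nat.succ` below `x`, so on `Γ` and `φ` it is `shift`.
  have h' := h.ren fun y => if y = x then 0 else y + 1
  have e : ∀ y < x, (if y = x then 0 else y + 1) = y.succ := fun y hy => by simp [hy.ne]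
  rw [ren_inst, hφ _ _ e, if_pos rfl, Set.image_congr fun ψ hψ => hΓ ψ hψ _ _ e] at h'
  exact .allI h'

/-! ## Consistent sets of formulas -/

/-- `Γ` is consistent. -/
def Con (Γ : Set (LSet.Formula ℕ)) : Prop := ¬Derives Γ ⊥

theorem Derives.ofFalse {Γ : Set (LSet.Formula ℕ)} {φ : LSet.Formula ℕ} (h : Derives Γ ⊥) :
    Derives Γ φ :=
  .byContradiction (h.mono (Set.subset_insert _ _))

theorem Derives.cut {Γ : Set (LSet.Formula ℕ)} {φ ψ : LSet.Formula ℕ} (h₁ : Derives Γ φ)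
    (h₂ : Derives (insert φ Γ) ψ) : Derives Γ ψ :=
  .impE (.impI h₂) h₁

/-- If the implication were refutable from `Γ`, then `Γ` would derive `inst φ x`; as `x` is fresh,
it would derive `φ.all`, and with it the implication. -/
theorem con_henkin {Γ : Set (LSet.Formula ℕ)} {φ : LSet.BoundedFormula ℕ 1} {x : ℕ}
    (hΓ : ∀ ψ ∈ Γ, VarsBelow x ψ) (hφ : VarsBelow x φ) (h : Con Γ) :
    Con (insert ((inst φ x).imp φ.all) Γ) := by
  intro hd
  have hn : Derives Γ ((inst φ x).imp φ.all).not := .impI hd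
  have hx : Derives Γ (inst φ x) := by
    refine .byContradiction (.impE (hn.mono (Set.subset_insert _ _)) (.impI ?_))
    exact .ofFalse (.impE (.hyp (Set.mem_insert_of_mem _ (Set.mem_insert _ _)))
      (.hyp (Set.mem_insert _ _)))
  exact h (.impE hn (.impI ((hx.generalize hΓ hφ).mono (Set.subset_insert _ _))))

theorem con_iUnion {H : ℕ → Set (LSet.Formula ℕ)} (hm : Monotone H) (h : ∀ i, Con (H i)) :
    Con (⋃ i, H i) := by
  intro hd
  obtain ⟨Δ, hs, hf, hd⟩ := hd.exists_finite
  lift Δ to Finset (LSet.Formula ℕ) using hf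
  obtain ⟨i, hi⟩ := hm.directed_le.exists_mem_subset_of_finset_subset_biUnion hs
  exact h i (hd.mono hi)

instance : Countable LSet.Symbols := by
  have h : Countable (Σ n, MemSymbol n) :=
    Function.Injective.countable (f := fun _ => ()) (by rintro ⟨_, ⟨⟩⟩ ⟨_, ⟨⟩⟩ _; rfl)
  have h' : Countable (Σ _ : ℕ, Empty) := inferInstance
  exact inferInstanceAs (Countable ((Σ _ : ℕ, Empty) ⊕ (Σ n, MemSymbol n)))

/-- Starting from closed formulas leaves every variable available, so the variables themselves serve
as Henkin constants and the language is not enlarged. -/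
theorem exists_henkin_extension {Γ : Set (LSet.Formula ℕ)} (hΓ : ∀ ψ ∈ Γ, VarsBelow 0 ψ)
    (h : Con Γ) : ∃ Δ, Γ ⊆ Δ ∧ Con Δ ∧
      ∀ φ : LSet.BoundedFormula ℕ 1, ∃ x, (inst φ x).imp φ.all ∈ Δ := by
  have : Countable (LSet.BoundedFormula ℕ 1) :=
    Function.Injective.countable (f := fun φ => (⟨1, φ⟩ : Σ n, LSet.BoundedFormula ℕ n))
      (fun _ _ h => by simpa using h)
  have : Nonempty (LSet.BoundedFormula ℕ 1) := ⟨⊥⟩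
  obtain ⟨e, he⟩ := exists_surjective_nat (LSet.BoundedFormula ℕ 1)
  choose b hb using fun i => exists_varsBelow (e i)
  -- `N i` exceeds every variable free in stage `H i`, and `b i` bounds those of `e i`; hence `x i`
  -- is fresh for both.
  let N : ℕ → ℕ := fun i => Nat.rec 0 (fun i k => max k (b i) + 1) i
  let x : ℕ → ℕ := fun i => max (N i) (b i)
  let H : ℕ → Set (LSet.Formula ℕ) := fun i =>
    Nat.rec Γ (fun i S => insert ((inst (e i) (x i)).imp (e i).all) S) i
  have hN : ∀ i, N (i + 1) = x i + 1 := fun i => rfl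
  have hH : ∀ i, H (i + 1) = insert ((inst (e i) (x i)).imp (e i).all) (H i) := fun i => rfl
  have hx : ∀ i, VarsBelow (x i) (e i) := fun i => (hb i).mono (le_max_right _ _)
  have hv : ∀ i, ∀ ψ ∈ H i, VarsBelow (N i) ψ := by
    intro i
    induction i with
    | zero => exact hΓ
    | succ i ih =>
      rw [hH, hN]
      refine Set.forall_mem_insert.2 ⟨?_, fun ψ hψ =>
        (ih ψ hψ).mono ((le_max_left _ _).trans (Nat.le_succ _))⟩
      have := (hx i).mono (Nat.le_succ _)
      exact (this.inst (Nat.lt_succ_self _)).imp this.all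
  have hc : ∀ i, Con (H i) := by
    intro i
    induction i with
    | zero => exact h
    | succ i ih =>
      exact con_henkin (fun ψ hψ => (hv i ψ hψ).mono (le_max_left _ _)) (hx i) ih
  have hm : Monotone H := monotone_nat_of_le_succ fun i => Set.subset_insert _ _
  refine ⟨⋃ i, H i, Set.subset_iUnion H 0, con_iUnion hm hc, fun φ => ?_⟩
  obtain ⟨i, rfl⟩ := he φ
  exact ⟨x i, Set.mem_iUnion.2 ⟨i + 1, Set.mem_insert _ _⟩⟩

/-- Zorn's lemma applies because a derivation uses finitely many hypotheses. Henkin implications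
already in `Γ` persist, so maximality can be imposed after them. -/
theorem exists_maximal_con {Γ : Set (LSet.Formula ℕ)} (h : Con Γ) :
    ∃ Δ, Γ ⊆ Δ ∧ Maximal Con Δ := by
  refine zorn_subset_nonempty {Δ | Con Δ} (fun c hc hch hne => ?_) Γ h
  refine ⟨⋃₀ c, fun hd => ?_, fun s hs => Set.subset_sUnion_of_mem hs⟩
  obtain ⟨Δ, hs, hf, hd⟩ := hd.exists_finite
  obtain ⟨s, hs, hΔ⟩ := hch.directedOn.exists_mem_subset_of_finite_of_subset_sUnion hne hf hs
  exact hc hs (hd.mono hΔ)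

section Maximal

variable {Δ : Set (LSet.Formula ℕ)}

theorem mem_of_derives (hΔ : Maximal Con Δ) {φ : LSet.Formula ℕ} (h : Derives Δ φ) : φ ∈ Δ :=
  hΔ.le_of_ge (y := insert φ Δ) (fun hd => hΔ.prop (h.cut hd)) (Set.subset_insert _ _)
    (Set.mem_insert _ _)

theorem not_mem_of_maximal (hΔ : Maximal Con Δ) {φ : LSet.Formula ℕ} (h : φ ∉ Δ) : φ.not ∈ Δ := by
  by_contra hn
  refine hn (mem_of_derives hΔ (.impI ?_))
  by_contra hc
  exact h (hΔ.le_of_ge (y := insert φ Δ) hc (Set.subset_insert _ _) (Set.mem_insert _ _))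

theorem imp_mem_iff (hΔ : Maximal Con Δ) {φ ψ : LSet.Formula ℕ} :
    φ.imp ψ ∈ Δ ↔ (φ ∈ Δ → ψ ∈ Δ) := by
  refine ⟨fun h hφ => mem_of_derives hΔ (.impE (.hyp h) (.hyp hφ)), fun h => ?_⟩
  by_cases hφ : φ ∈ Δ
  · exact mem_of_derives hΔ (.impI (.hyp (Set.mem_insert_of_mem _ (h hφ))))
  · exact mem_of_derives hΔ (.impI (.ofFalse (.impE
      (.hyp (Set.mem_insert_of_mem _ (not_mem_of_maximal hΔ hφ))) (.hyp (Set.mem_insert _ _)))))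

theorem all_mem_iff (hΔ : Maximal Con Δ)
    (hH : ∀ φ : LSet.BoundedFormula ℕ 1, ∃ x, (inst φ x).imp φ.all ∈ Δ)
    {φ : LSet.BoundedFormula ℕ 1} : φ.all ∈ Δ ↔ ∀ x, inst φ x ∈ Δ := by
  refine ⟨fun h x => mem_of_derives hΔ (.allE x (.hyp h)), fun h => ?_⟩
  obtain ⟨x, hx⟩ := hH φ
  exact (imp_mem_iff hΔ).1 hx (h x)

-- The term model and its truth lemma

/-- The formula `x = y`. -/
def eqFml (x y : ℕ) : LSet.Formula ℕ := Term.equal (Term.var x) (Term.var y)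

/-- The formula `x ∈ y`. -/
def memFml (x y : ℕ) : LSet.Formula ℕ := memF (Term.var (Sum.inl x)) (Term.var (Sum.inl y))

theorem eqFml_symm {Γ : Set (LSet.Formula ℕ)} {x y : ℕ} (h : Derives Γ (eqFml x y)) :
    Derives Γ (eqFml y x) := by
  have := Derives.eqSubst (Γ := Γ)
    (.equal (Term.var (Sum.inr 0)) (Term.var (Sum.inl x))) h (Derives.eqRefl x)
  exact this

theorem eqFml_trans {Γ : Set (LSet.Formula ℕ)} {x y z : ℕ} (h₁ : Derives Γ (eqFml x y))
    (h₂ : Derives Γ (eqFml y z)) : Derives Γ (eqFml x z) :=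
  Derives.eqSubst (Γ := Γ) (.equal (Term.var (Sum.inl x)) (Term.var (Sum.inr 0))) h₂ h₁

theorem inst_memF_left (x y : ℕ) :
    inst (memF (Term.var (Sum.inr 0)) (Term.var (Sum.inl y))) x = memFml x y := by
  simp only [inst, memFml, memF, Relations.boundedFormula₂, Relations.boundedFormula, rename]
  congr 1
  funext i
  fin_cases i <;> rfl

theorem inst_memF_right (x y : ℕ) :
    inst (memF (Term.var (Sum.inl x)) (Term.var (Sum.inr 0))) y = memFml x y := by
  simp only [inst, memFml, memF, Relations.boundedFormula₂, Relations.boundedFormula, rename]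
  congr 1
  funext i
  fin_cases i <;> rfl

theorem memFml_congr {Γ : Set (LSet.Formula ℕ)} {x y x' y' : ℕ} (hx : Derives Γ (eqFml x x'))
    (hy : Derives Γ (eqFml y y')) (h : Derives Γ (memFml x y)) : Derives Γ (memFml x' y') := by
  rw [← inst_memF_left] at h
  have h₁ := Derives.eqSubst _ hx h
  rw [inst_memF_left, ← inst_memF_right] at h₁
  have h₂ := Derives.eqSubst _ hy h₁
  rwa [inst_memF_right] at h₂

/-- Equality of variables, according to `Δ`. -/
def varSetoid (Δ : Set (LSet.Formula ℕ)) : Setoid ℕ where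
  r x y := Derives Δ (eqFml x y)
  iseqv := ⟨.eqRefl, eqFml_symm, eqFml_trans⟩

/-- The model whose elements are the variables, up to equality according to `Δ`. -/
def TermModel (Δ : Set (LSet.Formula ℕ)) : Type := Quotient (varSetoid Δ)

/-- The element of the term model given by a variable. -/
def TermModel.mk (Δ : Set (LSet.Formula ℕ)) (x : ℕ) : TermModel Δ := Quotient.mk (varSetoid Δ) x

instance : LSet.Structure (TermModel Δ) where
  funMap f := f.elim
  RelMap {n} R := match n, R with
    | _, .mem => fun xs => Derives Δ (memFml (Quotient.out (xs 0)) (Quotient.out (xs 1)))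

theorem TermModel.mk_eq_iff {x y : ℕ} :
    TermModel.mk Δ x = TermModel.mk Δ y ↔ Derives Δ (eqFml x y) :=
  Quotient.eq (r := varSetoid Δ)

/-- Membership is defined on chosen representatives; the equality rules make the choice irrelevant.
-/
theorem TermModel.relMap_iff (x y : ℕ) :
    Structure.RelMap (L := LSet) MemSymbol.mem ![TermModel.mk Δ x, TermModel.mk Δ y] ↔
      Derives Δ (memFml x y) := by
  have h : ∀ x, Derives Δ (eqFml (Quotient.out (TermModel.mk Δ x)) x) := fun x =>
    Quotient.mk_out (s := varSetoid Δ) x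
  exact ⟨memFml_congr (h x) (h y), memFml_congr (eqFml_symm (h x)) (eqFml_symm (h y))⟩

/-- The truth lemma. Substituting variables for the bound indices as well, by an arbitrary `σ`, is
what allows the induction to pass under quantifiers. -/
theorem realize_termModel_iff (hΔ : Maximal Con Δ)
    (hH : ∀ φ : LSet.BoundedFormula ℕ 1, ∃ x, (inst φ x).imp φ.all ∈ Δ)
    {n : ℕ} (φ : LSet.BoundedFormula ℕ n) (σ : ℕ ⊕ Fin n → ℕ) :
    (rename (Sum.inl ∘ σ) φ : LSet.Formula ℕ) ∈ Δ ↔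
      φ.Realize (fun a => TermModel.mk Δ (σ (Sum.inl a)))
        (fun i => TermModel.mk Δ (σ (Sum.inr i))) := by
  have hmem : ∀ ψ : LSet.Formula ℕ, ψ ∈ Δ ↔ Derives Δ ψ :=
    fun ψ => ⟨.hyp, mem_of_derives hΔ⟩
  have hterm : ∀ {n : ℕ} (t : LSet.Term (ℕ ⊕ Fin n)), ∃ y, t = Term.var y := by
    rintro n (y | ⟨f, _⟩)
    · exact ⟨y, rfl⟩
    · exact f.elim
  have hval : ∀ {n : ℕ} (σ : ℕ ⊕ Fin n → ℕ) (y : ℕ ⊕ Fin n),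
      Sum.elim (fun a => TermModel.mk Δ (σ (Sum.inl a)))
        (fun i => TermModel.mk Δ (σ (Sum.inr i))) y = TermModel.mk Δ (σ y) := by
    rintro n σ (y | y) <;> rfl
  induction φ with
  | falsum => exact iff_of_false (fun h => hΔ.prop (.hyp h)) id
  | equal s t =>
    obtain ⟨x, rfl⟩ := hterm s
    obtain ⟨y, rfl⟩ := hterm t
    rw [hmem, BoundedFormula.Realize, Term.realize_var, Term.realize_var, hval, hval,
      TermModel.mk_eq_iff]
    rfl
  | @rel n l R ts =>
    cases R
    obtain ⟨x, hx⟩ := hterm (ts 0)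
    obtain ⟨y, hy⟩ := hterm (ts 1)
    obtain rfl : ts = ![Term.var x, Term.var y] := by
      funext i; fin_cases i; exacts [hx, hy]
    have e : (fun i => Term.realize (Sum.elim (fun a => TermModel.mk Δ (σ (Sum.inl a)))
        (fun i => TermModel.mk Δ (σ (Sum.inr i)))) (![Term.var x, Term.var y] i :
          LSet.Term (ℕ ⊕ Fin n))) =
        ![TermModel.mk Δ (σ x), TermModel.mk Δ (σ y)] := by
      funext i; fin_cases i; exacts [hval σ x, hval σ y]
    rw [BoundedFormula.Realize, e, TermModel.relMap_iff, hmem]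
    have e' : (rename (Sum.inl ∘ σ) (.rel MemSymbol.mem ![Term.var x, Term.var y]) :
        LSet.Formula ℕ) = memFml (σ x) (σ y) := by
      simp only [memFml, memF, Relations.boundedFormula₂, Relations.boundedFormula, rename]
      congr 1
      funext i
      fin_cases i <;> rfl
    rw [e']
  | imp φ ψ ih₁ ih₂ =>
    exact (imp_mem_iff hΔ).trans (imp_congr (ih₁ σ) (ih₂ σ))
  | @all n φ ih =>
    rw [BoundedFormula.realize_all]
    have h := all_mem_iff hΔ hH (φ := rename (liftRen (Sum.inl ∘ σ)) φ)
    refine h.trans ?_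
    have hsurj : Function.Surjective (TermModel.mk Δ) := Quotient.mk_surjective
    rw [hsurj.forall]
    refine forall_congr' fun x => ?_
    have hi := ih (Sum.elim (σ ∘ Sum.inl) (Fin.snoc (σ ∘ Sum.inr) x : Fin (n + 1) → ℕ))
    have e : inst (rename (liftRen (Sum.inl ∘ σ)) φ) x = (rename (Sum.inl ∘
        (Sum.elim (σ ∘ Sum.inl) (Fin.snoc (σ ∘ Sum.inr) x : Fin (n + 1) → ℕ))) φ) := by
      rw [inst, rename_rename]
      congr 1
      refine ext_up (fun y => ?_) (by simp)
      rw [Function.comp_apply, liftRen_up]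
      rcases y with y | y <;> simp [up]
    rw [e]
    refine Iff.trans hi (iff_of_eq (congrArg₂ _ rfl ?_))
    funext i
    refine Fin.lastCases ?_ (fun j => ?_) i <;> simp

end Maximal

/-- Gödel's completeness theorem. -/
theorem exists_model_of_not_proves {T : LSet.Theory} {φ : LSet.Sentence} (h : ¬Proves T φ) :
    ∃ (M : Type) (_ : LSet.Structure M), Nonempty M ∧ M ⊨ T ∧ ¬M ⊨ φ := by
  have hs : ∀ (ψ : LSet.Sentence) (N : ℕ), VarsBelow N (ofSentence ψ) := fun ψ N σ τ _ => by
    rw [ren_ofSentence, ren_ofSentence]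
  have hc : Con (insert (ofSentence φ).not (ofSentence '' T)) :=
    fun hd => h (.byContradiction hd)
  obtain ⟨Δ₀, h₀, hc₀, hH₀⟩ := exists_henkin_extension (by
    refine Set.forall_mem_insert.2 ⟨(hs φ 0).imp (fun _ _ _ => rfl), ?_⟩
    rintro _ ⟨ψ, _, rfl⟩
    exact hs ψ 0) hc
  obtain ⟨Δ, h₁, hΔ⟩ := exists_maximal_con hc₀
  have hH : ∀ φ : LSet.BoundedFormula ℕ 1, ∃ x, (inst φ x).imp φ.all ∈ Δ := fun φ =>
    (hH₀ φ).imp fun x hx => h₁ hx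
  have key : ∀ ψ : LSet.Sentence, ofSentence ψ ∈ Δ ↔ TermModel Δ ⊨ ψ := by
    intro ψ
    have := realize_termModel_iff hΔ hH (ofSentence ψ) (Sum.elim id Fin.elim0)
    rw [realize_ofSentence] at this
    rw [← this]
    have e : (rename (Sum.inl ∘ Sum.elim id Fin.elim0) (ofSentence ψ) : LSet.Formula ℕ) =
        ofSentence ψ := by
      rw [ofSentence, rename_rename]
      congr 1
      funext y
      rcases y with y | y
      · exact y.elim
      · exact y.elim0
    rw [e]
  refine ⟨TermModel Δ, inferInstance, ⟨TermModel.mk Δ 0⟩, ?_, fun hφ => ?_⟩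
  · exact ⟨fun ψ hψ => (key ψ).1 (h₁ (h₀ (Set.mem_insert_of_mem _ ⟨ψ, hψ, rfl⟩)))⟩
  · exact hΔ.prop (.impE (.hyp (h₁ (h₀ (Set.mem_insert _ _)))) (.hyp ((key φ).2 hφ)))

/-! ## Semantics of the axioms -/

section Semantics

variable {M : Type} [LSet.Structure M]

/-- The membership relation of a structure. -/
def Mem (x y : M) : Prop := Structure.RelMap (L := LSet) MemSymbol.mem ![x, y]

/-- Inclusion in a structure. -/
def Sub (x y : M) : Prop := ∀ u, Mem u x → Mem u y

/-- `y` is the powerset of `x`. -/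
def IsPow (y x : M) : Prop := ∀ u, Mem u y ↔ Sub u x

/-- `x` is a transitive set. -/
def IsTransSet (x : M) : Prop := ∀ u, Mem u x → Sub u x

/-- `w` contains the empty set and is closed under successors. -/
def IsInductive (w : M) : Prop :=
  (∃ e, Mem e w ∧ ∀ u, ¬Mem u e) ∧
    ∀ y, Mem y w → ∃ s, Mem s w ∧ ∀ u, Mem u s ↔ Mem u y ∨ u = y

variable {α : Type} {n : ℕ} {v : α → M} {xs : Fin n → M}

@[simp] theorem realize_upT (t : LSet.Term (α ⊕ Fin n)) (x : M) :
    (upT t).realize (Sum.elim v (Fin.snoc xs x : Fin (n + 1) → M)) =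
      t.realize (Sum.elim v xs) := by
  rw [upT, Term.realize_relabel]
  congr 1
  funext y
  rcases y with y | y <;> simp [up]

@[simp] theorem realize_memF (s t : LSet.Term (α ⊕ Fin n)) :
    (memF s t).Realize v xs ↔
      Mem (s.realize (Sum.elim v xs)) (t.realize (Sum.elim v xs)) :=
  BoundedFormula.realize_rel₂

@[simp] theorem realize_subF (s t : LSet.Term (α ⊕ Fin n)) :
    (subF s t).Realize v xs ↔
      Sub (s.realize (Sum.elim v xs)) (t.realize (Sum.elim v xs)) := by
  simp [subF, Sub]

variable {v : Empty → M}

@[simp] theorem realize_allMem (t : LSet.Term (Empty ⊕ Fin n)) (φ : Fml (n + 1)) :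
    (allMem t φ).Realize v xs ↔
      ∀ x, Mem x (t.realize (Sum.elim v xs)) → φ.Realize v (Fin.snoc xs x) := by
  simp [allMem]

@[simp] theorem realize_exMem (t : LSet.Term (Empty ⊕ Fin n)) (φ : Fml (n + 1)) :
    (exMem t φ).Realize v xs ↔
      ∃ x, Mem x (t.realize (Sum.elim v xs)) ∧ φ.Realize v (Fin.snoc xs x) := by
  simp [exMem]

@[simp] theorem realize_allSub (t : LSet.Term (Empty ⊕ Fin n)) (φ : Fml (n + 1)) :
    (allSub t φ).Realize v xs ↔
      ∀ x, Sub x (t.realize (Sum.elim v xs)) → φ.Realize v (Fin.snoc xs x) := by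
  simp [allSub]

@[simp] theorem realize_exSub (t : LSet.Term (Empty ⊕ Fin n)) (φ : Fml (n + 1)) :
    (exSub t φ).Realize v xs ↔
      ∃ x, Sub x (t.realize (Sum.elim v xs)) ∧ φ.Realize v (Fin.snoc xs x) := by
  simp [exSub]

theorem realize_app1 {m : ℕ} (φ : Fml (n + 1)) (i : Fin m) (xs : Fin (n + m) → M) :
    (app1 m φ i).Realize v xs ↔
      φ.Realize v (Fin.snoc (fun j => xs (Fin.castAdd m j)) (xs (Fin.natAdd n i))) := by
  rw [app1, realize_rename]
  refine iff_of_eq (congrArg₂ _ (Subsingleton.elim _ _) ?_)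
  funext j
  refine Fin.lastCases ?_ (fun j => ?_) j
  · have : Fin.append (Fin.castAdd m) ![Fin.natAdd n i] (Fin.last n) = Fin.natAdd n i :=
      Fin.append_right (Fin.castAdd m) ![Fin.natAdd n i] 0
    simp [this]
  · have : Fin.append (Fin.castAdd m) ![Fin.natAdd n i] j.castSucc = Fin.castAdd m j :=
      Fin.append_left (Fin.castAdd m) ![Fin.natAdd n i] j
    simp [this]

theorem realize_app2 {m : ℕ} (φ : Fml (n + 2)) (i j : Fin m) (xs : Fin (n + m) → M) :
    (app2 m φ i j).Realize v xs ↔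
      φ.Realize v (Fin.snoc (Fin.snoc (fun j => xs (Fin.castAdd m j)) (xs (Fin.natAdd n i)) :
        Fin (n + 1) → M) (xs (Fin.natAdd n j))) := by
  rw [app2, realize_rename]
  refine iff_of_eq (congrArg₂ _ (Subsingleton.elim _ _) ?_)
  have h := Fin.append_right (Fin.castAdd m) ![Fin.natAdd n i, Fin.natAdd n j]
  funext k
  refine Fin.lastCases ?_ (fun k => Fin.lastCases ?_ (fun k => ?_) k) k
  · have : Fin.append (Fin.castAdd m) ![Fin.natAdd n i, Fin.natAdd n j] (Fin.last (n + 1)) =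
      Fin.natAdd n j := h 1
    simp [this]
  · have : Fin.append (Fin.castAdd m) ![Fin.natAdd n i, Fin.natAdd n j] (Fin.last n).castSucc =
      Fin.natAdd n i := h 0
    simp [this]
  · have : Fin.append (Fin.castAdd m) ![Fin.natAdd n i, Fin.natAdd n j] k.castSucc.castSucc =
      Fin.castAdd m k := Fin.append_left _ _ k
    simp [this]

theorem realize_extensionality :
    M ⊨ extensionality ↔ ∀ x y : M, (∀ u, Mem u x ↔ Mem u y) → x = y := by
  simp [extensionality, Sentence.Realize, Formula.Realize, Fin.snoc]

theorem realize_emptySet : M ⊨ emptySet ↔ ∃ x : M, ∀ u, ¬Mem u x := by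
  simp [emptySet, Sentence.Realize, Formula.Realize, Fin.snoc]

theorem realize_pairing :
    M ⊨ pairing ↔ ∀ x y : M, ∃ z, ∀ u, Mem u z ↔ u = x ∨ u = y := by
  simp [pairing, Sentence.Realize, Formula.Realize, Fin.snoc]

theorem realize_unionAx :
    M ⊨ unionAx ↔ ∀ x : M, ∃ y, ∀ u, Mem u y ↔ ∃ v, Mem v x ∧ Mem u v := by
  simp [unionAx, Sentence.Realize, Formula.Realize, Fin.snoc]

theorem realize_setDifference :
    M ⊨ setDifference ↔ ∀ x y : M, ∃ z, ∀ u, Mem u z ↔ Mem u x ∧ ¬Mem u y := by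
  simp [setDifference, Sentence.Realize, Formula.Realize, Fin.snoc]

theorem realize_powersetAx : M ⊨ powersetAx ↔ ∀ x : M, ∃ y, IsPow y x := by
  simp [powersetAx, Sentence.Realize, Formula.Realize, Fin.snoc, IsPow]

theorem realize_transitiveContainment :
    M ⊨ transitiveContainment ↔ ∀ x : M, ∃ y, IsTransSet y ∧ Sub x y := by
  simp [transitiveContainment, Sentence.Realize, Formula.Realize, Fin.snoc, IsTransSet, Sub]

theorem realize_infinityAx : M ⊨ infinityAx ↔ ∃ w : M, IsInductive w := by
  simp [infinityAx, Sentence.Realize, Formula.Realize, Fin.snoc, IsInductive]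

theorem realize_setFoundation :
    M ⊨ setFoundation ↔
      ∀ z : M, (∃ x, Mem x z) → ∃ y, Mem y z ∧ ∀ x, Mem x y → ¬Mem x z := by
  simp [setFoundation, Sentence.Realize, Formula.Realize, Fin.snoc]

theorem realize_choiceAx :
    M ⊨ choiceAx ↔ ∀ F : M, (∀ x, Mem x F → ∃ u, Mem u x) →
      (∀ x y, Mem x F → Mem y F → ∀ u, Mem u x → Mem u y → x = y) →
      ∃ C, ∀ x, Mem x F → ∃ u, (Mem u x ∧ Mem u C) ∧ ∀ u', Mem u' x → Mem u' C → u' = u := by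
  simp [choiceAx, Sentence.Realize, Formula.Realize, Fin.snoc]

theorem realize_separationFor (φ : Fml (n + 1)) :
    M ⊨ separationFor φ ↔ ∀ (xs : Fin n → M) (w : M), ∃ y, ∀ x,
      Mem x y ↔ Mem x w ∧ φ.Realize default (Fin.snoc xs x) := by
  rw [separationFor, Sentence.Realize, BoundedFormula.realize_alls]
  refine forall_congr' fun xs => ?_
  rw [BoundedFormula.realize_all]
  refine forall_congr' fun w => ?_
  rw [BoundedFormula.realize_ex]
  refine exists_congr fun y => ?_
  rw [BoundedFormula.realize_all]
  refine forall_congr' fun x => ?_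
  rw [BoundedFormula.realize_iff, BoundedFormula.realize_inf, realize_memF, realize_memF,
    realize_app1]
  have h0 : Fin.natAdd n (0 : Fin 3) = (Fin.last n).castSucc.castSucc := rfl
  have h1 : Fin.natAdd n (1 : Fin 3) = (Fin.last (n + 1)).castSucc := rfl
  have h2 : Fin.natAdd n (2 : Fin 3) = Fin.last (n + 2) := rfl
  have h3 : ∀ j : Fin n, Fin.castAdd 3 j = j.castSucc.castSucc.castSucc := fun j => rfl
  simp only [bv, Function.comp_apply, Term.realize_var, Sum.elim_inr, h0, h1, h2, h3, Fin.snoc_last,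
    Fin.snoc_castSucc]

theorem realize_collectionFor (φ : Fml (n + 2)) :
    M ⊨ collectionFor φ ↔ ∀ (xs : Fin n → M) (w : M),
      (∀ x, Mem x w → ∃ y, φ.Realize default (Fin.snoc (Fin.snoc xs x : Fin (n + 1) → M) y)) →
      ∃ C, ∀ x, Mem x w → ∃ y, Mem y C ∧
        φ.Realize default (Fin.snoc (Fin.snoc xs x : Fin (n + 1) → M) y) := by
  rw [collectionFor, Sentence.Realize, BoundedFormula.realize_alls]
  refine forall_congr' fun xs => ?_
  rw [BoundedFormula.realize_all]
  refine forall_congr' fun w => ?_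
  have a0 : Fin.natAdd n (0 : Fin 2) = (Fin.last n).castSucc := rfl
  have a1 : Fin.natAdd n (1 : Fin 2) = Fin.last (n + 1) := rfl
  have h0 : Fin.natAdd n (0 : Fin 3) = (Fin.last n).castSucc.castSucc := rfl
  have h1 : Fin.natAdd n (1 : Fin 3) = (Fin.last (n + 1)).castSucc := rfl
  have h2 : Fin.natAdd n (2 : Fin 3) = Fin.last (n + 2) := rfl
  have h3 : ∀ j : Fin n, Fin.castAdd 3 j = j.castSucc.castSucc.castSucc := fun j => rfl
  have k1 : Fin.natAdd n (1 : Fin 4) = (Fin.last (n + 1)).castSucc.castSucc := rfl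
  have k2 : Fin.natAdd n (2 : Fin 4) = (Fin.last (n + 2)).castSucc := rfl
  have k3 : Fin.natAdd n (3 : Fin 4) = Fin.last (n + 3) := rfl
  have k4 : ∀ j : Fin n, Fin.castAdd 4 j = j.castSucc.castSucc.castSucc.castSucc := fun j => rfl
  rw [BoundedFormula.realize_imp, BoundedFormula.realize_all, BoundedFormula.realize_ex]
  refine imp_congr (forall_congr' fun x => ?_) (exists_congr fun C => ?_)
  · rw [BoundedFormula.realize_imp, BoundedFormula.realize_ex, realize_memF]
    simp only [bv, Function.comp_apply, Term.realize_var, Sum.elim_inr, a0, a1, Fin.snoc_last, Fin.snoc_castSucc]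
    refine imp_congr Iff.rfl (exists_congr fun y => ?_)
    refine (realize_app2 φ 1 2 _).trans ?_
    simp only [h1, h2, h3, Fin.snoc_last, Fin.snoc_castSucc]
  · rw [BoundedFormula.realize_all]
    refine forall_congr' fun x => ?_
    rw [BoundedFormula.realize_imp, BoundedFormula.realize_ex, realize_memF]
    simp only [bv, Function.comp_apply, Term.realize_var, Sum.elim_inr, h0, h2, Fin.snoc_last, Fin.snoc_castSucc]
    refine imp_congr Iff.rfl (exists_congr fun y => ?_)
    rw [BoundedFormula.realize_inf, realize_memF]
    refine and_congr ?_ ((realize_app2 φ 2 3 _).trans ?_)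
    · simp only [Term.realize_var, Sum.elim_inr, k1, k3, Fin.snoc_last, Fin.snoc_castSucc]
    · simp only [k2, k3, k4, Fin.snoc_last, Fin.snoc_castSucc]

end Semantics

/-- The structure `M` is a model of the theory `M`. -/
structure IsModel (M : Type) [LSet.Structure M] : Prop where
  ext : ∀ x y : M, (∀ u, Mem u x ↔ Mem u y) → x = y
  empty : ∃ x : M, ∀ u, ¬Mem u x
  pair : ∀ x y : M, ∃ z, ∀ u, Mem u z ↔ u = x ∨ u = y
  union : ∀ x : M, ∃ y, ∀ u, Mem u y ↔ ∃ v, Mem v x ∧ Mem u v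
  diff : ∀ x y : M, ∃ z, ∀ u, Mem u z ↔ Mem u x ∧ ¬Mem u y
  pow : ∀ x : M, ∃ y, IsPow y x
  trans : ∀ x : M, ∃ y, IsTransSet y ∧ Sub x y
  infinity : ∃ w : M, IsInductive w
  foundation : ∀ z : M, (∃ x, Mem x z) → ∃ y, Mem y z ∧ ∀ x, Mem x y → ¬Mem x z
  sep : ∀ {n : ℕ} (φ : Fml (n + 1)), IsDelta0 (n + 1) φ → ∀ (xs : Fin n → M) (w : M), ∃ y, ∀ x,
    Mem x y ↔ Mem x w ∧ φ.Realize default (Fin.snoc xs x)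

theorem models_theoryM_iff {M : Type} [LSet.Structure M] : M ⊨ theoryM ↔ IsModel M := by
  rw [Theory.model_iff]
  constructor
  · intro h
    refine ⟨realize_extensionality.1 (h _ ?_), realize_emptySet.1 (h _ ?_),
      realize_pairing.1 (h _ ?_), realize_unionAx.1 (h _ ?_), realize_setDifference.1 (h _ ?_),
      realize_powersetAx.1 (h _ ?_), realize_transitiveContainment.1 (h _ ?_),
      realize_infinityAx.1 (h _ ?_), realize_setFoundation.1 (h _ ?_),
      fun φ hφ => (realize_separationFor φ).1 (h _ (Or.inr ⟨_, φ, hφ, rfl⟩))⟩ <;>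
    simp [theoryM, theoryS1]
  · rintro h σ ((hσ | hσ) | ⟨n, φ, hφ, rfl⟩)
    · rcases hσ with rfl | rfl | rfl | rfl | rfl | rfl
      exacts [realize_extensionality.2 h.ext, realize_emptySet.2 h.empty,
        realize_pairing.2 h.pair, realize_unionAx.2 h.union, realize_setDifference.2 h.diff,
        realize_powersetAx.2 h.pow]
    · rcases hσ with rfl | rfl | rfl
      exacts [realize_transitiveContainment.2 h.trans, realize_infinityAx.2 h.infinity,
        realize_setFoundation.2 h.foundation]
    · exact (realize_separationFor φ).2 (h.sep φ hφ)

/-! ## Closure properties of the classes of formulas -/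

theorem IsDelta0.isDelta0P {n : ℕ} {φ : Fml n} (h : IsDelta0 n φ) : IsDelta0P n φ := by
  induction h with
  | atomic h => exact .atomic h
  | falsum => exact .falsum
  | imp _ _ ih₁ ih₂ => exact .imp ih₁ ih₂
  | allMem t _ ih => exact .allMem t ih
  | exMem t _ ih => exact .exMem t ih

theorem IsDelta0.inf {n : ℕ} {φ ψ : Fml n} (h₁ : IsDelta0 n φ) (h₂ : IsDelta0 n ψ) :
    IsDelta0 n (φ ⊓ ψ) :=
  .imp (.imp h₁ (.imp h₂ .falsum)) .falsum

theorem isDelta0_subF {n : ℕ} (s t : LSet.Term (Empty ⊕ Fin n)) : IsDelta0 n (subF s t) :=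
  .allMem s (.atomic (.rel _ _))

theorem isAtomic_rename {n m : ℕ} (σ : Empty ⊕ Fin n → Empty ⊕ Fin m) {φ : Fml n}
    (h : φ.IsAtomic) : (rename σ φ).IsAtomic := by
  cases h with
  | equal t₁ t₂ => exact .equal _ _
  | rel R ts => exact .rel _ _

theorem upT_relabel {α β : Type} {n m : ℕ} (σ : α ⊕ Fin n → β ⊕ Fin m)
    (t : LSet.Term (α ⊕ Fin n)) : (upT t).relabel (liftRen σ) = upT (t.relabel σ) := by
  rw [upT, upT, Term.relabel_relabel, Term.relabel_relabel]
  congr 1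
  funext x
  exact liftRen_up σ x

theorem rename_memF {α β : Type} {n m : ℕ} (σ : α ⊕ Fin n → β ⊕ Fin m)
    (s t : LSet.Term (α ⊕ Fin n)) :
    rename σ (memF s t) = memF (s.relabel σ) (t.relabel σ) := by
  simp only [memF, Relations.boundedFormula₂, Relations.boundedFormula, rename]
  congr 1
  funext i
  fin_cases i <;> rfl

theorem rename_last_memF {α β : Type} {n m : ℕ} (σ : α ⊕ Fin n → β ⊕ Fin m)
    (t : LSet.Term (α ⊕ Fin n)) :
    rename (liftRen σ) (memF (Term.var (Sum.inr (Fin.last n))) (upT t)) =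
      memF (Term.var (Sum.inr (Fin.last m))) (upT (t.relabel σ)) := by
  rw [rename_memF, upT_relabel, Term.relabel, liftRen_last]

theorem rename_last_subF {α β : Type} {n m : ℕ} (σ : α ⊕ Fin n → β ⊕ Fin m)
    (t : LSet.Term (α ⊕ Fin n)) :
    rename (liftRen σ) (subF (Term.var (Sum.inr (Fin.last n))) (upT t)) =
      subF (Term.var (Sum.inr (Fin.last m))) (upT (t.relabel σ)) := by
  simp only [subF, rename, Function.comp_apply]
  rw [rename_last_memF, rename_last_memF, upT_relabel, Term.relabel, liftRen_last]

theorem rename_allMem {n m : ℕ} (σ : Empty ⊕ Fin n → Empty ⊕ Fin m)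
    (t : LSet.Term (Empty ⊕ Fin n)) (φ : Fml (n + 1)) :
    rename σ (allMem t φ) = allMem (t.relabel σ) (rename (liftRen σ) φ) := by
  simp only [allMem, rename, Function.comp_apply, rename_last_memF]

theorem rename_exMem {n m : ℕ} (σ : Empty ⊕ Fin n → Empty ⊕ Fin m)
    (t : LSet.Term (Empty ⊕ Fin n)) (φ : Fml (n + 1)) :
    rename σ (exMem t φ) = exMem (t.relabel σ) (rename (liftRen σ) φ) := by
  rw [exMem, exMem, Function.comp_apply, Function.comp_apply, ← rename_last_memF]
  rfl

theorem rename_allSub {n m : ℕ} (σ : Empty ⊕ Fin n → Empty ⊕ Fin m)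
    (t : LSet.Term (Empty ⊕ Fin n)) (φ : Fml (n + 1)) :
    rename σ (allSub t φ) = allSub (t.relabel σ) (rename (liftRen σ) φ) := by
  simp only [allSub, rename, Function.comp_apply, rename_last_subF]

theorem rename_exSub {n m : ℕ} (σ : Empty ⊕ Fin n → Empty ⊕ Fin m)
    (t : LSet.Term (Empty ⊕ Fin n)) (φ : Fml (n + 1)) :
    rename σ (exSub t φ) = exSub (t.relabel σ) (rename (liftRen σ) φ) := by
  rw [exSub, exSub, Function.comp_apply, Function.comp_apply, ← rename_last_subF]
  rfl

theorem isDelta0P_rename {n m : ℕ} {φ : Fml n} (h : IsDelta0P n φ)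
    (σ : Empty ⊕ Fin n → Empty ⊕ Fin m) : IsDelta0P m (rename σ φ) := by
  induction h generalizing m with
  | atomic h => exact .atomic (isAtomic_rename σ h)
  | falsum => exact .falsum
  | imp _ _ ih₁ ih₂ => exact .imp (ih₁ σ) (ih₂ σ)
  | allMem t _ ih =>
    rw [rename_allMem]
    exact .allMem _ (ih _)
  | exMem t _ ih =>
    rw [rename_exMem]
    exact .exMem _ (ih _)
  | allSub t _ ih =>
    rw [rename_allSub]
    exact .allSub _ (ih _)
  | exSub t _ ih =>
    rw [rename_exSub]
    exact .exSub _ (ih _)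

/-! ## `Δ₀^𝒫`-separation -/

section Separation

variable {M : Type} [LSet.Structure M]

theorem Sub.trans {x y z : M} (h₁ : Sub x y) (h₂ : Sub y z) : Sub x z :=
  fun u hu => h₂ u (h₁ u hu)

theorem IsTransSet.sub_pow {T P : M} (hT : IsTransSet T) (hP : IsPow P T) : Sub T P :=
  fun u hu => (hP u).2 (hT u hu)

theorem IsTransSet.pow {T P : M} (hT : IsTransSet T) (hP : IsPow P T) : IsTransSet P :=
  fun u hu => Sub.trans ((hP u).1 hu) (hT.sub_pow hP)

theorem IsPow.mem {T P : M} (hP : IsPow P T) : Mem T P := (hP T).2 fun _ h => h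

theorem IsModel.union₂ (hM : IsModel M) (x y : M) : ∃ z, ∀ u, Mem u z ↔ Mem u x ∨ Mem u y := by
  obtain ⟨p, hp⟩ := hM.pair x y
  obtain ⟨z, hz⟩ := hM.union p
  refine ⟨z, fun u => (hz u).trans ⟨?_, ?_⟩⟩
  · rintro ⟨v, hv, hu⟩
    rcases (hp v).1 hv with rfl | rfl
    exacts [Or.inl hu, Or.inr hu]
  · rintro (h | h)
    exacts [⟨x, (hp x).2 (Or.inl rfl), h⟩, ⟨y, (hp y).2 (Or.inr rfl), h⟩]

theorem IsModel.insert (hM : IsModel M) (x y : M) : ∃ z, ∀ u, Mem u z ↔ Mem u x ∨ u = y := by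
  obtain ⟨p, hp⟩ := hM.pair y y
  obtain ⟨z, hz⟩ := hM.union₂ x p
  exact ⟨z, fun u => (hz u).trans (or_congr_right ((hp u).trans or_self_iff))⟩

/-- Finitely many elements lie in some transitive set. -/
theorem IsModel.exists_trans_mem (hM : IsModel M) {n : ℕ} (xs : Fin n → M) :
    ∃ T, IsTransSet T ∧ ∀ i, Mem (xs i) T := by
  have : ∃ s, ∀ i, Mem (xs i) s := by
    induction n with
    | zero => exact hM.empty.imp fun _ _ i => i.elim0
    | succ n ih =>
      obtain ⟨s, hs⟩ := ih fun i => xs i.castSucc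
      obtain ⟨z, hz⟩ := hM.insert s (xs (Fin.last n))
      exact ⟨z, Fin.lastCases ((hz _).2 (Or.inr rfl)) fun i => (hz _).2 (Or.inl (hs i))⟩
  obtain ⟨s, hs⟩ := this
  obtain ⟨T, hT, hsT⟩ := hM.trans s
  exact ⟨T, hT, fun i => hsT _ (hs i)⟩

/-- The renaming of variables that frees the variable `&0`. -/
def succRen (n : ℕ) : Empty ⊕ Fin n → Empty ⊕ Fin (n + 1) := Sum.map id Fin.succ

theorem realize_relabel_succRen {n : ℕ} (t : LSet.Term (Empty ⊕ Fin n)) (B : M) (xs : Fin n → M) :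
    (t.relabel (succRen n)).realize (Sum.elim default (Fin.cons B xs : Fin (n + 1) → M)) =
      t.realize (Sum.elim default xs) := by
  rw [Term.realize_relabel]
  congr 1
  funext y
  rcases y with y | y
  · rfl
  · simp [succRen]

theorem realize_mem_of_forall {n : ℕ} (t : LSet.Term (Empty ⊕ Fin n)) {xs : Fin n → M} {T : M}
    (h : ∀ i, Mem (xs i) T) : Mem (t.realize (Sum.elim default xs)) T := by
  rcases t with (y | i) | ⟨f, _⟩
  exacts [y.elim, h i, f.elim]

theorem forall_snoc_mem {n : ℕ} {xs : Fin n → M} {x T : M} (h : ∀ i, Mem (xs i) T)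
    (hx : Mem x T) (i : Fin (n + 1)) : Mem ((Fin.snoc xs x : Fin (n + 1) → M) i) T := by
  refine Fin.lastCases ?_ (fun i => ?_) i
  · rwa [Fin.snoc_last]
  · rw [Fin.snoc_castSucc]
    exact h i

/-- On the elements of a transitive set, a `Δ₀^𝒫`-formula is equivalent to a `Δ₀`-formula in which
a sufficiently large set, the value of the variable `&0`, bounds the quantifiers over subsets. -/
theorem IsModel.exists_delta0 (hM : IsModel M) {n : ℕ} {φ : Fml n} (h : IsDelta0P n φ) :
    ∃ ψ : Fml (n + 1), IsDelta0 (n + 1) ψ ∧ ∀ T : M, IsTransSet T → ∃ B, ∀ B', Sub B B' →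
      ∀ xs : Fin n → M, (∀ i, Mem (xs i) T) →
        (ψ.Realize default (Fin.cons B' xs) ↔ φ.Realize default xs) := by
  induction h with
  | @atomic n φ h =>
    refine ⟨rename (succRen n) φ, .atomic (isAtomic_rename _ h), fun T _ => ⟨T, fun B _ xs _ => ?_⟩⟩
    rw [realize_rename]
    refine iff_of_eq (congrArg₂ _ (Subsingleton.elim _ _) ?_)
    funext i
    simp [succRen]
  | falsum => exact ⟨⊥, .falsum, fun T _ => ⟨T, fun B _ xs _ => Iff.rfl⟩⟩
  | imp _ _ ih₁ ih₂ =>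
    obtain ⟨ψ₁, hψ₁, h₁⟩ := ih₁
    obtain ⟨ψ₂, hψ₂, h₂⟩ := ih₂
    refine ⟨ψ₁.imp ψ₂, .imp hψ₁ hψ₂, fun T hT => ?_⟩
    obtain ⟨B₁, hB₁⟩ := h₁ T hT
    obtain ⟨B₂, hB₂⟩ := h₂ T hT
    -- Because the equivalence holds for all supersets of a bound, one variable `&0` can serve both
    -- subformulas.
    obtain ⟨B, hB⟩ := hM.union₂ B₁ B₂
    refine ⟨B, fun B' hB' xs hxs => ?_⟩
    rw [BoundedFormula.realize_imp, BoundedFormula.realize_imp,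
      hB₁ B' (fun u hu => hB' u ((hB u).2 (Or.inl hu))) xs hxs,
      hB₂ B' (fun u hu => hB' u ((hB u).2 (Or.inr hu))) xs hxs]
  | @allMem n t φ _ ih =>
    obtain ⟨ψ, hψ, h⟩ := ih
    refine ⟨allMem (t.relabel (succRen n)) ψ, .allMem _ hψ, fun T hT => ?_⟩
    obtain ⟨B, hB⟩ := h T hT
    refine ⟨B, fun B' hB' xs hxs => ?_⟩
    rw [realize_allMem, realize_allMem, realize_relabel_succRen]
    refine forall_congr' fun x => imp_congr_right fun hx => ?_
    rw [← Fin.cons_snoc_eq_snoc_cons]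
    exact hB B' hB' _ (forall_snoc_mem hxs (hT _ (realize_mem_of_forall t hxs) _ hx))
  | @exMem n t φ _ ih =>
    obtain ⟨ψ, hψ, h⟩ := ih
    refine ⟨exMem (t.relabel (succRen n)) ψ, .exMem _ hψ, fun T hT => ?_⟩
    obtain ⟨B, hB⟩ := h T hT
    refine ⟨B, fun B' hB' xs hxs => ?_⟩
    rw [realize_exMem, realize_exMem, realize_relabel_succRen]
    refine exists_congr fun x => and_congr_right fun hx => ?_
    rw [← Fin.cons_snoc_eq_snoc_cons]
    exact hB B' hB' _ (forall_snoc_mem hxs (hT _ (realize_mem_of_forall t hxs) _ hx))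
  | @allSub n t φ _ ih =>
    obtain ⟨ψ, hψ, h⟩ := ih
    refine ⟨allMem (Term.var (Sum.inr 0)) ((subF (Term.var (Sum.inr (Fin.last (n + 1))))
      (upT (t.relabel (succRen n)))).imp ψ), .allMem _ (.imp (isDelta0_subF _ _) hψ),
      fun T hT => ?_⟩
    -- Subsets of elements of `T` lie in `P`, which is again transitive, so the induction hypothesis
    -- is used for `P`. The bound must include `P`, the range of the quantifier, and `B₁`, the bound
    -- needed for the inner formula.
    obtain ⟨P, hP⟩ := hM.pow T
    obtain ⟨B₁, hB₁⟩ := h P (hT.pow hP)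
    obtain ⟨B, hB⟩ := hM.union₂ P B₁
    refine ⟨B, fun B' hB' xs hxs => ?_⟩
    rw [realize_allMem, realize_allSub]
    refine forall_congr' fun x => ?_
    rw [BoundedFormula.realize_imp, realize_subF, realize_upT, realize_relabel_succRen,
      Term.realize_var, Term.realize_var, Sum.elim_inr, Sum.elim_inr, Fin.snoc_last, Fin.cons_zero]
    have hxP : Sub x (t.realize (Sum.elim default xs)) → Mem x P := fun hx =>
      (hP x).2 (hx.trans (hT _ (realize_mem_of_forall t hxs)))
    have key : Sub x (t.realize (Sum.elim default xs)) →
        (ψ.Realize default (Fin.snoc (Fin.cons B' xs : Fin (n + 1) → M) x) ↔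
          φ.Realize default (Fin.snoc xs x)) := fun hx => by
      rw [← Fin.cons_snoc_eq_snoc_cons]
      exact hB₁ B' (fun u hu => hB' u ((hB u).2 (Or.inr hu))) _
        (forall_snoc_mem (fun i => hT.sub_pow hP _ (hxs i)) (hxP hx))
    exact ⟨fun H hx => (key hx).1 (H (hB' x ((hB x).2 (Or.inl (hxP hx)))) hx),
      fun H _ hx => (key hx).2 (H hx)⟩
  | @exSub n t φ _ ih =>
    obtain ⟨ψ, hψ, h⟩ := ih
    refine ⟨exMem (Term.var (Sum.inr 0)) (subF (Term.var (Sum.inr (Fin.last (n + 1))))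
      (upT (t.relabel (succRen n))) ⊓ ψ), .exMem _ ((isDelta0_subF _ _).inf hψ),
      fun T hT => ?_⟩
    obtain ⟨P, hP⟩ := hM.pow T
    obtain ⟨B₁, hB₁⟩ := h P (hT.pow hP)
    obtain ⟨B, hB⟩ := hM.union₂ P B₁
    refine ⟨B, fun B' hB' xs hxs => ?_⟩
    rw [realize_exMem, realize_exSub]
    refine exists_congr fun x => ?_
    rw [BoundedFormula.realize_inf, realize_subF, realize_upT, realize_relabel_succRen,
      Term.realize_var, Term.realize_var, Sum.elim_inr, Sum.elim_inr, Fin.snoc_last, Fin.cons_zero]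
    have hxP : Sub x (t.realize (Sum.elim default xs)) → Mem x P := fun hx =>
      (hP x).2 (hx.trans (hT _ (realize_mem_of_forall t hxs)))
    have key : Sub x (t.realize (Sum.elim default xs)) →
        (ψ.Realize default (Fin.snoc (Fin.cons B' xs : Fin (n + 1) → M) x) ↔
          φ.Realize default (Fin.snoc xs x)) := fun hx => by
      rw [← Fin.cons_snoc_eq_snoc_cons]
      exact hB₁ B' (fun u hu => hB' u ((hB u).2 (Or.inr hu))) _
        (forall_snoc_mem (fun i => hT.sub_pow hP _ (hxs i)) (hxP hx))
    exact ⟨fun ⟨_, hx, H⟩ => ⟨hx, (key hx).1 H⟩,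
      fun ⟨hx, H⟩ => ⟨hB' x ((hB x).2 (Or.inl (hxP hx))), hx, (key hx).2 H⟩⟩

/-- The bound `B` enters `Δ₀`-separation as one more parameter. The transitive set `T` contains the
parameters and `w`, hence also every candidate `x ∈ w`. -/
theorem IsModel.sepP (hM : IsModel M) {n : ℕ} {φ : Fml (n + 1)} (h : IsDelta0P (n + 1) φ)
    (xs : Fin n → M) (w : M) :
    ∃ y, ∀ x, Mem x y ↔ Mem x w ∧ φ.Realize default (Fin.snoc xs x) := by
  obtain ⟨ψ, hψ, hB⟩ := hM.exists_delta0 h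
  obtain ⟨T, hT, hxs⟩ := hM.exists_trans_mem (Fin.snoc xs w : Fin (n + 1) → M)
  obtain ⟨B, hB⟩ := hB T hT
  obtain ⟨y, hy⟩ := hM.sep ψ hψ (Fin.cons B xs) w
  refine ⟨y, fun x => (hy x).trans (and_congr_right fun hx => ?_)⟩
  rw [← Fin.cons_snoc_eq_snoc_cons]
  have hw : Mem w T := by simpa using hxs (Fin.last n)
  exact hB B (fun _ h => h) _
    (forall_snoc_mem (fun i => by simpa using hxs i.castSucc) (hT w hw x hx))

end Separation

/-! ## Parts of a model that are closed under elements and subsets -/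

/-- The substructure of the elements with the property `p`. -/
def Part {N : Type} (p : N → Prop) : Type := {x // p x}

theorem Part.snoc {N : Type} {p : N → Prop} {n : ℕ} (xs : Fin n → Part p) (x : Part p) :
    (fun i => ((Fin.snoc xs x : Fin (n + 1) → Part p) i).1) =
      (Fin.snoc (fun i => (xs i).1) x.1 : Fin (n + 1) → N) := by
  funext i
  refine Fin.lastCases ?_ (fun i => ?_) i <;> simp

section Part

variable {N : Type} [LSet.Structure N] {p : N → Prop}

instance : LSet.Structure (Part p) where
  funMap f := f.elim
  RelMap R xs := Structure.RelMap R fun i => (xs i).1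

theorem Part.mem_iff (x y : Part p) : Mem x y ↔ Mem x.1 y.1 := by
  have e : (fun i => ((![x, y] : Fin 2 → Part p) i).1) = ![x.1, y.1] := by
    funext i; fin_cases i <;> rfl
  change Structure.RelMap (L := LSet) MemSymbol.mem (fun i => ((![x, y] : Fin 2 → Part p) i).1) ↔ _
  rw [e]
  rfl

theorem Part.realize_term {n : ℕ} (t : LSet.Term (Empty ⊕ Fin n)) (xs : Fin n → Part p) :
    (t.realize (Sum.elim default xs)).1 =
      t.realize (Sum.elim (default : Empty → N) fun i => (xs i).1) := by
  rcases t with (y | i) | ⟨f, _⟩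
  exacts [y.elim, rfl, f.elim]

theorem Part.sub_iff (hp : ∀ x y, Mem x y → p y → p x) (x y : Part p) :
    Sub x y ↔ Sub x.1 y.1 := by
  constructor
  · intro h u hu
    exact (mem_iff ⟨u, hp _ _ hu x.2⟩ y).1 (h _ ((mem_iff _ _).2 hu))
  · intro h u hu
    exact (mem_iff _ _).2 (h _ ((mem_iff _ _).1 hu))

theorem Part.realize_atomic {n : ℕ} {φ : Fml n} (h : φ.IsAtomic) (xs : Fin n → Part p) :
    φ.Realize default xs ↔ φ.Realize default fun i => (xs i).1 := by
  cases h with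
  | equal s t =>
    rw [BoundedFormula.realize_bdEqual, BoundedFormula.realize_bdEqual, ← realize_term,
      ← realize_term]
    exact Subtype.ext_iff
  | rel R ts =>
    rw [BoundedFormula.realize_rel, BoundedFormula.realize_rel]
    simp only [← realize_term]
    rfl

/-- Closure under elements and subsets means that every bounded quantifier ranges over the same
objects in the part and in the whole structure. -/
theorem Part.realize_iff (hp : ∀ x y, Mem x y → p y → p x) (hs : ∀ x y, Sub x y → p y → p x)
    {n : ℕ} {φ : Fml n} (h : IsDelta0P n φ) (xs : Fin n → Part p) :
    φ.Realize default xs ↔ φ.Realize default fun i => (xs i).1 := by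
  induction h with
  | atomic h => exact realize_atomic h xs
  | falsum => exact Iff.rfl
  | imp _ _ ih₁ ih₂ => exact imp_congr (ih₁ xs) (ih₂ xs)
  | allMem t _ ih =>
    rw [realize_allMem, realize_allMem]
    simp only [← realize_term, ih, snoc, mem_iff]
    exact ⟨fun H x hx => H ⟨x, hp _ _ hx (Subtype.prop _)⟩ hx, fun H x hx => H x.1 hx⟩
  | exMem t _ ih =>
    rw [realize_exMem, realize_exMem]
    simp only [← realize_term, ih, snoc, mem_iff]
    exact ⟨fun ⟨x, hx⟩ => ⟨x.1, hx⟩, fun ⟨x, hx, H⟩ => ⟨⟨x, hp _ _ hx (Subtype.prop _)⟩, hx, H⟩⟩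
  | allSub t _ ih =>
    rw [realize_allSub, realize_allSub]
    simp only [← realize_term, ih, snoc, sub_iff hp]
    exact ⟨fun H x hx => H ⟨x, hs _ _ hx (Subtype.prop _)⟩ hx, fun H x hx => H x.1 hx⟩
  | exSub t _ ih =>
    rw [realize_exSub, realize_exSub]
    simp only [← realize_term, ih, snoc, sub_iff hp]
    exact ⟨fun ⟨x, hx⟩ => ⟨x.1, hx⟩, fun ⟨x, hx, H⟩ => ⟨⟨x, hs _ _ hx (Subtype.prop _)⟩, hx, H⟩⟩

end Part

/-! ## Towers of powersets -/

/-- `T` is the sequence of the iterated powersets of a transitive set that contains an inductive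
set. -/
structure IsTower {N : Type} [LSet.Structure N] (T : ℕ → N) : Prop where
  trans : IsTransSet (T 0)
  pow : ∀ k, IsPow (T (k + 1)) (T k)
  infinity : ∃ w, Mem w (T 0) ∧ IsInductive w

section Tower

variable {N : Type} [LSet.Structure N] {T : ℕ → N}

/-- The union of a sequence of sets. -/
def Below (T : ℕ → N) (x : N) : Prop := ∃ k, Mem x (T k)

theorem IsTower.trans_succ (hT : IsTower T) (k : ℕ) : IsTransSet (T k) := by
  induction k with
  | zero => exact hT.trans
  | succ k ih => exact ih.pow (hT.pow k)

theorem IsTower.sub_of_le (hT : IsTower T) {k l : ℕ} (h : k ≤ l) : Sub (T k) (T l) := by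
  induction h with
  | refl => exact fun _ h => h
  | step _ ih => exact ih.trans ((hT.trans_succ _).sub_pow (hT.pow _))

theorem IsTower.below_of_sub (hT : IsTower T) {x : N} {k : ℕ} (h : Sub x (T k)) : Below T x :=
  ⟨k + 1, (hT.pow k x).2 h⟩

theorem IsTower.exists_sub (hT : IsTower T) {x : N} (h : Below T x) : ∃ k, Sub x (T k) :=
  h.imp fun k hk => hT.trans_succ k x hk

theorem IsTower.below_of_mem (hT : IsTower T) (x y : N) (h : Mem x y) (hy : Below T y) :
    Below T x := by
  obtain ⟨k, hk⟩ := hT.exists_sub hy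
  exact ⟨k, hk x h⟩

theorem IsTower.below_of_sub_below (hT : IsTower T) (x y : N) (h : Sub x y) (hy : Below T y) :
    Below T x := by
  obtain ⟨k, hk⟩ := hT.exists_sub hy
  exact hT.below_of_sub (h.trans hk)

theorem IsTower.exists_mem_fin (hT : IsTower T) {n : ℕ} (xs : Fin n → Part (Below T)) :
    ∃ k, ∀ i, Mem (xs i).1 (T k) := by
  choose k hk using fun i => (xs i).2
  exact ⟨Finset.univ.sup k, fun i => hT.sub_of_le (Finset.le_sup (Finset.mem_univ i)) _ (hk i)⟩

/-- To give an element of the part below a tower, give a set of the model whose elements lie in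
the tower. -/
theorem IsTower.exists_part (hT : IsTower T) {q : N → Prop} (k : ℕ) (h : ∀ u, q u → Mem u (T k))
    (hz : ∃ z, ∀ u, Mem u z ↔ q u) : ∃ z : Part (Below T), ∀ u : Part (Below T),
      Mem u z ↔ q u.1 := by
  obtain ⟨z, hz⟩ := hz
  exact ⟨⟨z, hT.below_of_sub fun u hu => h u ((hz u).1 hu)⟩, fun u =>
    (Part.mem_iff _ _).trans (hz u.1)⟩

/-- Sets formed in `N` from elements of the tower are included in some level, hence belong to the
next one. The levels themselves are transitive and give transitive containment; separation uses
absoluteness. -/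
theorem IsTower.isModel (hN : IsModel N) (hT : IsTower T) : IsModel (Part (Below T)) := by
  have hm := hT.below_of_mem
  have hs := hT.below_of_sub_below
  have hsub : ∀ x : Part (Below T), ∃ k, Sub x.1 (T k) := fun x => hT.exists_sub x.2
  refine ⟨fun x y h => ?_, ?_, fun x y => ?_, fun x => ?_, fun x y => ?_, fun x => ?_, fun x => ?_,
    ?_, fun z => ?_, fun {n} φ hφ xs w => ?_⟩
  · refine Subtype.ext (hN.ext _ _ fun u => ⟨fun hu => ?_, fun hu => ?_⟩)
    · exact (Part.mem_iff ⟨u, hm _ _ hu x.2⟩ y).1 ((h _).1 ((Part.mem_iff _ _).2 hu))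
    · exact (Part.mem_iff ⟨u, hm _ _ hu y.2⟩ x).1 ((h _).2 ((Part.mem_iff _ _).2 hu))
  · obtain ⟨z, hz⟩ := hT.exists_part (q := fun _ => False) 0 (fun _ h => h.elim)
      (hN.empty.imp fun x hx u => iff_false_intro (hx u))
    exact ⟨z, fun u hu => (hz u).1 hu⟩
  · obtain ⟨k, hk⟩ := hT.exists_mem_fin ![x, y]
    obtain ⟨z, hz⟩ := hT.exists_part k (by
      rintro u (rfl | rfl)
      exacts [hk 0, hk 1]) (hN.pair x.1 y.1)
    exact ⟨z, fun u => (hz u).trans (or_congr Subtype.ext_iff.symm Subtype.ext_iff.symm)⟩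
  · obtain ⟨k, hk⟩ := hsub x
    obtain ⟨z, hz⟩ := hT.exists_part k
      (fun u ⟨v, hv, hu⟩ => hT.trans_succ k v (hk v hv) u hu) (hN.union x.1)
    refine ⟨z, fun u => (hz u).trans ?_⟩
    simp only [Part.mem_iff]
    exact ⟨fun ⟨v, hv, hu⟩ => ⟨⟨v, hm _ _ hv x.2⟩, hv, hu⟩, fun ⟨v, h⟩ => ⟨v.1, h⟩⟩
  · obtain ⟨k, hk⟩ := hsub x
    obtain ⟨z, hz⟩ := hT.exists_part k (fun u hu => hk u hu.1) (hN.diff x.1 y.1)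
    refine ⟨z, fun u => (hz u).trans ?_⟩
    simp only [Part.mem_iff]
  · obtain ⟨k, hk⟩ := hsub x
    obtain ⟨z, hz⟩ := hT.exists_part (k + 1) (fun u hu => (hT.pow k u).2 (hu.trans hk))
      (hN.pow x.1)
    exact ⟨z, fun u => (hz u).trans (Part.sub_iff hm _ _).symm⟩
  · obtain ⟨k, hk⟩ := hsub x
    refine ⟨⟨T k, hT.below_of_sub fun _ h => h⟩, fun u hu => ?_, (Part.sub_iff hm _ _).2 hk⟩
    exact (Part.sub_iff hm _ _).2 (hT.trans_succ k _ ((Part.mem_iff _ _).1 hu))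
  · obtain ⟨w, hw, ⟨e, he, hemp⟩, hsucc⟩ := hT.infinity
    have hw' : Below T w := ⟨0, hw⟩
    refine ⟨⟨w, hw'⟩, ⟨⟨e, hm _ _ he hw'⟩, ?_, fun u hu => ?_⟩, fun y hy => ?_⟩
    · exact (Part.mem_iff _ _).2 he
    · exact hemp _ ((Part.mem_iff _ _).1 hu)
    · obtain ⟨s, hs, h⟩ := hsucc y.1 ((Part.mem_iff _ _).1 hy)
      refine ⟨⟨s, hm _ _ hs hw'⟩, (Part.mem_iff _ _).2 hs, fun u => ?_⟩
      exact (Part.mem_iff _ _).trans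
        ((h u.1).trans (or_congr (Part.mem_iff _ _).symm Subtype.ext_iff.symm))
  · rintro ⟨x, hx⟩
    obtain ⟨y, hy, h⟩ := hN.foundation z.1 ⟨x.1, (Part.mem_iff _ _).1 hx⟩
    refine ⟨⟨y, hm _ _ hy z.2⟩, (Part.mem_iff _ _).2 hy, fun x hx hxz => ?_⟩
    exact h x.1 ((Part.mem_iff _ _).1 hx) ((Part.mem_iff _ _).1 hxz)
  · obtain ⟨k, hk⟩ := hsub w
    obtain ⟨z, hz⟩ := hT.exists_part k (fun u hu => hk u hu.1)
      (hN.sep φ hφ (fun i => (xs i).1) w.1)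
    refine ⟨z, fun u => (hz u).trans ?_⟩
    rw [Part.mem_iff, Part.realize_iff hm hs hφ.isDelta0P, Part.snoc]

/-- A transversal in `N` may have members outside the tower. Intersecting it with `U = ⋃ F` loses
nothing relevant, and `U \ (U \ C)` provides that intersection. -/
theorem IsTower.choice (hN : IsModel N) (hT : IsTower T) (hc : N ⊨ choiceAx) :
    Part (Below T) ⊨ choiceAx := by
  have hm := hT.below_of_mem
  rw [realize_choiceAx] at hc ⊢
  intro F hne hdis
  have hF : ∀ {x}, Mem x F.1 → Below T x := fun hx => hm _ _ hx F.2
  have h₁ : ∀ x, Mem x F.1 → ∃ u, Mem u x := fun x hx => by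
    obtain ⟨u, hu⟩ := hne ⟨x, hF hx⟩ ((Part.mem_iff _ _).2 hx)
    exact ⟨u.1, (Part.mem_iff _ _).1 hu⟩
  have h₂ : ∀ x y, Mem x F.1 → Mem y F.1 → ∀ u, Mem u x → Mem u y → x = y := by
    intro x y hx hy u hux huy
    have := hdis ⟨x, hF hx⟩ ⟨y, hF hy⟩ ((Part.mem_iff _ _).2 hx) ((Part.mem_iff _ _).2 hy)
      ⟨u, hm _ _ hux (hF hx)⟩ ((Part.mem_iff _ _).2 hux) ((Part.mem_iff _ _).2 huy)
    exact congrArg Subtype.val this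
  obtain ⟨C, hC⟩ := hc F.1 h₁ h₂
  obtain ⟨k, hk⟩ := hT.exists_sub F.2
  obtain ⟨U, hU⟩ := hN.union F.1
  obtain ⟨D, hD⟩ := hN.diff U C
  obtain ⟨z, hz⟩ := hT.exists_part k (fun u hu => by
    obtain ⟨v, hv, hu⟩ := (hU u).1 hu.1
    exact hT.trans_succ k v (hk v hv) u hu) (hN.diff U D)
  refine ⟨z, fun x hx => ?_⟩
  have hx' := (Part.mem_iff _ _).1 hx
  have key : ∀ u : Part (Below T), Mem u x → (Mem u z ↔ Mem u.1 C) := fun u hu => by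
    have huU : Mem u.1 U := (hU u.1).2 ⟨x.1, hx', (Part.mem_iff _ _).1 hu⟩
    rw [hz, hD]
    tauto
  obtain ⟨u, ⟨hux, huC⟩, huniq⟩ := hC x.1 hx'
  have hux' := (Part.mem_iff ⟨u, hm _ _ hux x.2⟩ x).2 hux
  refine ⟨_, ⟨hux', (key _ hux').2 huC⟩, fun u' hu' huz => Subtype.ext ?_⟩
  exact huniq u'.1 ((Part.mem_iff _ _).1 hu') ((key u' hu').1 huz)

-- Collection by underspill along a chain of powersets

/-- The set `c` is a chain of powersets over `t`. -/
def IsChainOver (c t : N) : Prop :=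
  ∀ y, Mem y c → Sub t y ∧ (y = t ∨ ∃ x, Mem x c ∧ IsPow y x)

/-- A member of the chain is either a standard level or lies above all of them. In the inductive
step `y` is the powerset of some `x` in the chain: if `x` is `T i`, extensionality makes `y` equal
to `T (i + 1)`, and if `T k ⊆ x`, then `T (k + 1) ⊆ y`. -/
theorem IsChainOver.eq_or_sub (hN : IsModel N) (hT : IsTower T) {c : N}
    (hc : IsChainOver c (T 0)) (k : ℕ) {y : N} (hy : Mem y c) :
    (∃ i, y = T i) ∨ Sub (T k) y := by
  induction k generalizing y with
  | zero => exact Or.inr (hc y hy).1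
  | succ k ih =>
    rcases (hc y hy).2 with rfl | ⟨x, hx, hxy⟩
    · exact Or.inl ⟨0, rfl⟩
    · rcases ih hx with ⟨i, rfl⟩ | h
      · exact Or.inl ⟨i + 1, hN.ext _ _ fun u => (hxy u).trans (hT.pow i u).symm⟩
      · exact Or.inr fun u hu => (hxy u).2 (((hT.pow k u).1 hu).trans h)

/-- If a tower is exceeded by an element of a chain of powersets over its base, then
`Δ₀^𝒫`-collection holds below the tower. -/
theorem IsTower.collection (hN : IsModel N) (hT : IsTower T) {c d : N}
    (hc : IsChainOver c (T 0)) (hd : Mem d c) (hTd : ∀ k, Sub (T k) d) {n : ℕ} {φ : Fml (n + 2)}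
    (hφ : IsDelta0P (n + 2) φ) : Part (Below T) ⊨ collectionFor φ := by
  rw [realize_collectionFor]
  intro xs w H
  have hm := hT.below_of_mem
  have hs := hT.below_of_sub_below
  -- `χ(w, y)` says that `y` contains a `φ`-witness for each member of `w`. It remains `Δ₀^𝒫`, so it
  -- separates a set `A` from the chain.
  let χ : Fml (n + 2) := allMem (Term.var (Sum.inr (Fin.last n).castSucc))
    (exMem (Term.var (Sum.inr (Fin.last (n + 1)).castSucc)) (app2 4 φ 2 3))
  have hχ : IsDelta0P (n + 2) χ := .allMem _ (.exMem _ (isDelta0P_rename hφ _))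
  have hreal : ∀ (zs : Fin n → N) (w y : N),
      χ.Realize default (Fin.snoc (Fin.snoc zs w : Fin (n + 1) → N) y) ↔
        ∀ x, Mem x w → ∃ u, Mem u y ∧
          φ.Realize default (Fin.snoc (Fin.snoc zs x : Fin (n + 1) → N) u) := by
    intro zs w y
    have k2 : Fin.natAdd n (2 : Fin 4) = (Fin.last (n + 2)).castSucc := rfl
    have k3 : Fin.natAdd n (3 : Fin 4) = Fin.last (n + 3) := rfl
    have k4 : ∀ j : Fin n, Fin.castAdd 4 j = j.castSucc.castSucc.castSucc.castSucc := fun j => rfl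
    rw [realize_allMem]
    simp only [Term.realize_var, Sum.elim_inr, Fin.snoc_castSucc, Fin.snoc_last]
    refine forall_congr' fun x => imp_congr_right fun _ => ?_
    rw [realize_exMem]
    simp only [Term.realize_var, Sum.elim_inr, Fin.snoc_castSucc, Fin.snoc_last]
    refine exists_congr fun u => and_congr_right fun _ => (realize_app2 φ 2 3 _).trans ?_
    simp only [k2, k3, k4, Fin.snoc_last, Fin.snoc_castSucc]
  obtain ⟨A, hA⟩ := hN.sepP hχ (Fin.snoc (fun i => (xs i).1) w.1) c
  simp only [hreal] at hA
  have habs : ∀ x u : Part (Below T),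
      φ.Realize default (Fin.snoc (Fin.snoc xs x : Fin (n + 1) → Part (Below T)) u) ↔
        φ.Realize default
          (Fin.snoc (Fin.snoc (fun i => (xs i).1) x.1 : Fin (n + 1) → N) u.1) := by
    intro x u
    rw [Part.realize_iff hm hs hφ, Part.snoc, Part.snoc]
  have hmemA : ∀ y, Mem y c → (∀ k, Sub (T k) y) → Mem y A := by
    refine fun y hy hTy => (hA y).2 ⟨hy, fun x hx => ?_⟩
    obtain ⟨u, hu⟩ := H ⟨x, hm _ _ hx w.2⟩ ((Part.mem_iff _ _).2 hx)
    obtain ⟨k, hk⟩ := u.2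
    exact ⟨u.1, hTy k _ hk, (habs _ _).1 hu⟩
  -- Foundation is available for sets only, while the standard levels need not form a set; hence
  -- minimality is applied to `A`, nonempty by the nonstandard member `d`.
  obtain ⟨y, hyA, hmin⟩ := hN.foundation A ⟨d, hmemA d hd hTd⟩
  obtain ⟨hyc, hy⟩ := (hA y).1 hyA
  have hyT : ∃ i, y = T i := by
    by_contra hne
    have hsub : ∀ k, Sub (T k) y := fun k =>
      (hc.eq_or_sub hN hT k hyc).resolve_left hne
    rcases (hc y hyc).2 with h | ⟨x, hx, hxy⟩
    · exact hne ⟨0, h⟩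
    -- If `y = 𝒫(x)` includes every level, then `T k ∈ T (k + 1) ⊆ 𝒫(x)` gives `T k ⊆ x`. So `x` is
    -- again nonstandard and lies in `A`, against the minimality of `y`.
    · refine hmin x hxy.mem (hmemA x hx fun k => ?_)
      exact (hxy (T k)).1 (hsub (k + 1) _ (hT.pow k).mem)
  obtain ⟨i, rfl⟩ := hyT
  refine ⟨⟨T i, hT.below_of_sub fun _ h => h⟩, fun x hx => ?_⟩
  obtain ⟨u, hu, hφu⟩ := hy x.1 ((Part.mem_iff _ _).1 hx)
  exact ⟨⟨u, ⟨i, hu⟩⟩, (Part.mem_iff _ _).2 hu, (habs _ _).2 hφu⟩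

end Tower

/-! ## Ultrapowers -/

/-- The ultrapower of `N` with respect to a nonprincipal ultrafilter on the natural numbers. -/
abbrev UPow (N : Type) : Type := (Filter.hyperfilter ℕ : Filter ℕ).Product fun _ => N

/-- The element of the ultrapower given by a sequence. -/
noncomputable def germ {N : Type} (f : ℕ → N) : UPow N := Quotient.mk _ f

section Ultrapower

variable {N : Type} [LSet.Structure N] [Nonempty N]

theorem realize_germ {n : ℕ} (φ : Fml n) (f : Fin n → ℕ → N) :
    φ.Realize default (fun i => germ (f i)) ↔
      ∀ᶠ a in Filter.hyperfilter ℕ, φ.Realize default fun i => f i a := by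
  have h := Ultraproduct.boundedFormula_realize_cast (M := fun _ : ℕ => N)
    (u := Filter.hyperfilter ℕ) φ (fun e : Empty => e.elim) f
  have e₁ : (fun e : Empty => Quotient.mk _ (e.elim : ℕ → N)) = (default : Empty → UPow N) :=
    Subsingleton.elim _ _
  have e₂ : ∀ a : ℕ, (fun e : Empty => (e.elim : ℕ → N) a) = default := fun a =>
    Subsingleton.elim _ _
  simp only [e₂] at h
  rw [← h]
  exact iff_of_eq (congrArg₂ _ e₁.symm rfl)

theorem mem_germ (f g : ℕ → N) :
    Mem (germ f) (germ g) ↔ ∀ᶠ a in Filter.hyperfilter ℕ, Mem (f a) (g a) := by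
  simpa using realize_germ (memF (&0) (&1) : Fml 2) ![f, g]

theorem sub_germ (f g : ℕ → N) :
    Sub (germ f) (germ g) ↔ ∀ᶠ a in Filter.hyperfilter ℕ, Sub (f a) (g a) := by
  simpa using realize_germ (subF (&0) (&1) : Fml 2) ![f, g]

theorem isTransSet_germ (f : ℕ → N) :
    IsTransSet (germ f) ↔ ∀ᶠ a in Filter.hyperfilter ℕ, IsTransSet (f a) := by
  simpa [Fin.snoc, IsTransSet] using
    realize_germ (∀' ((memF (&1) (&0)) ⟹ (subF (&1) (&0))) : Fml 1) ![f]

theorem isPow_germ (f g : ℕ → N) :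
    IsPow (germ f) (germ g) ↔ ∀ᶠ a in Filter.hyperfilter ℕ, IsPow (f a) (g a) := by
  simpa [Fin.snoc, IsPow] using
    realize_germ (∀' ((memF (&2) (&0)) ⇔ (subF (&2) (&1))) : Fml 2) ![f, g]

theorem isInductive_germ (f : ℕ → N) :
    IsInductive (germ f) ↔ ∀ᶠ a in Filter.hyperfilter ℕ, IsInductive (f a) := by
  simpa [Fin.snoc, IsInductive] using realize_germ
    ((∃' ((memF (&1) (&0)) ⊓ ∀' ∼(memF (&2) (&1)))) ⊓
      ∀' ((memF (&1) (&0)) ⟹ ∃' ((memF (&2) (&0)) ⊓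
        ∀' ((memF (&3) (&2)) ⇔ ((memF (&3) (&1)) ⊔ (&3 =' &1))))) : Fml 1) ![f]

theorem isChainOver_germ (f g : ℕ → N) :
    IsChainOver (germ f) (germ g) ↔ ∀ᶠ a in Filter.hyperfilter ℕ, IsChainOver (f a) (g a) := by
  simpa [Fin.snoc, IsChainOver, IsPow] using realize_germ
    (∀' ((memF (&2) (&0)) ⟹ ((subF (&1) (&2)) ⊓ ((&2 =' &1) ⊔
      ∃' ((memF (&3) (&0)) ⊓ ∀' ((memF (&4) (&2)) ⇔ (subF (&4) (&3))))))) : Fml 2) ![f, g]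

theorem models_uPow {T : LSet.Theory} (h : N ⊨ T) : UPow N ⊨ T :=
  (Theory.model_iff _).2 fun φ hφ => (Ultraproduct.sentence_realize φ).2
    (Filter.Eventually.of_forall fun _ => h.realize_of_mem φ hφ)

end Ultrapower

/-! ## The conservation theorem -/

theorem IsModel.exists_tower {N : Type} [LSet.Structure N] (hN : IsModel N) {n : ℕ}
    (xs : Fin n → N) : ∃ T : ℕ → N, IsTower T ∧ ∀ i, Mem (xs i) (T 0) := by
  obtain ⟨w, hw⟩ := hN.infinity
  -- An inductive set is put into the base along with the tuple, so that infinity holds below the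
  -- tower.
  obtain ⟨S, hS, hxs⟩ := hN.exists_trans_mem (Fin.snoc xs w : Fin (n + 1) → N)
  choose P hP using hN.pow
  refine ⟨fun k => P^[k] S, ⟨hS, fun k => ?_, w, by simpa using hxs (Fin.last n), hw⟩,
    fun i => by simpa using hxs i.castSucc⟩
  rw [Function.iterate_succ_apply']
  exact hP _

/-- The chain is `{T 0, …, T k}`, built by an external induction on `k`. The whole sequence need not
be a set of `N`; nonstandard chains come from the ultrapower. -/
theorem IsTower.exists_chain {N : Type} [LSet.Structure N] (hN : IsModel N) {T : ℕ → N}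
    (hT : IsTower T) (k : ℕ) : ∃ c, IsChainOver c (T 0) ∧ Mem (T k) c := by
  have h : ∃ c, ∀ u, Mem u c ↔ ∃ i ≤ k, u = T i := by
    induction k with
    | zero =>
      obtain ⟨c, hc⟩ := hN.pair (T 0) (T 0)
      exact ⟨c, fun u => (hc u).trans (by simp)⟩
    | succ k ih =>
      obtain ⟨c, hc⟩ := ih
      obtain ⟨c', hc'⟩ := hN.insert c (T (k + 1))
      refine ⟨c', fun u => (hc' u).trans ?_⟩
      rw [hc]
      constructor
      · rintro (⟨i, hi, rfl⟩ | rfl)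
        exacts [⟨i, hi.trans (Nat.le_succ _), rfl⟩, ⟨k + 1, le_rfl, rfl⟩]
      · rintro ⟨i, hi, rfl⟩
        rcases Nat.le_succ_iff.1 hi with hi | rfl
        exacts [Or.inl ⟨i, hi, rfl⟩, Or.inr rfl]
  obtain ⟨c, hc⟩ := h
  refine ⟨c, fun y hy => ?_, (hc _).2 ⟨k, le_rfl, rfl⟩⟩
  obtain ⟨i, hi, rfl⟩ := (hc y).1 hy
  refine ⟨hT.sub_of_le (Nat.zero_le i), ?_⟩
  cases i with
  | zero => exact Or.inl rfl
  | succ i => exact Or.inr ⟨T i, (hc _).2 ⟨i, (Nat.le_succ i).trans hi, rfl⟩, hT.pow i⟩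

/-- Existential witnesses found in the part remain witnesses outside it; the converse can fail, so
only upward preservation is claimed. -/
theorem Part.realize_exBlock {N : Type} [LSet.Structure N] {p : N → Prop}
    (hp : ∀ x y, Mem x y → p y → p x) (hs : ∀ x y, Sub x y → p y → p x)
    {n : ℕ} {φ : Fml n} (h : ExBlock IsDelta0P n φ) (xs : Fin n → Part p)
    (hφ : φ.Realize default xs) : φ.Realize default fun i => (xs i).1 := by
  induction h with
  | base h => exact (realize_iff hp hs h xs).1 hφ
  | ex _ ih =>
    obtain ⟨x, hx⟩ := BoundedFormula.realize_ex.1 hφ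
    have h := ih _ hx
    rw [snoc] at h
    exact BoundedFormula.realize_ex.2 ⟨x.1, h⟩

/-- Each finite tuple of elements of a model of `M` is mapped to some model of
`Δ₀^𝒫`-collection so that no new `Σ₁^𝒫`-formulas become true. -/
theorem IsModel.exists_collection_model {N : Type} [LSet.Structure N] [Nonempty N]
    (hN : IsModel N) {n : ℕ} (xs : Fin n → N) :
    ∃ (K : Type) (_ : LSet.Structure K) (ys : Fin n → K), Nonempty K ∧
      K ⊨ theoryM ∪ collection IsDelta0P ∧ (N ⊨ choiceAx → K ⊨ choiceAx) ∧
      ∀ φ : Fml n, ExBlock IsDelta0P n φ → φ.Realize default ys → φ.Realize default xs := by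
  obtain ⟨T, hT, hxs⟩ := hN.exists_tower xs
  choose c hc hTc using hT.exists_chain hN
  have hU : IsModel (UPow N) := models_theoryM_iff.1 (models_uPow (models_theoryM_iff.2 hN))
  let S : ℕ → UPow N := fun k => germ fun _ => T k
  have hS : IsTower S := by
    refine ⟨(isTransSet_germ _).2 (.of_forall fun _ => hT.trans),
      fun k => (isPow_germ _ _).2 (.of_forall fun _ => hT.pow k), ?_⟩
    obtain ⟨w, hw, hw'⟩ := hT.infinity
    exact ⟨germ fun _ => w, (mem_germ _ _).2 (.of_forall fun _ => hw),
      (isInductive_germ _).2 (.of_forall fun _ => hw')⟩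
  -- The diagonal germ of `T` lies above every constant germ `S k`: `T k ⊆ T a` for all `a ≥ k`, and
  -- a nonprincipal ultrafilter contains the cofinite sets.
  have hcoll {m : ℕ} {φ : Fml (m + 2)} := hS.collection (n := m) (φ := φ) hU (c := germ c)
    (d := germ T)
    ((isChainOver_germ _ _).2 (.of_forall hc)) ((mem_germ _ _).2 (.of_forall hTc))
    (fun k => (sub_germ _ _).2 (Nat.hyperfilter_le_atTop
      ((Filter.eventually_ge_atTop k).mono fun a ha => hT.sub_of_le ha)))
  refine ⟨Part (Below S), inferInstance, fun i => ⟨germ fun _ => xs i, 0,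
    (mem_germ _ _).2 (.of_forall fun _ => hxs i)⟩, ⟨⟨S 0, 1, (hS.pow 0).mem⟩⟩, ?_, fun h => ?_,
    fun φ hφ h => ?_⟩
  · refine (Theory.model_iff _).2 ?_
    rintro σ (hσ | ⟨n, φ, hφ, rfl⟩)
    · exact (models_theoryM_iff.2 (hS.isModel hU)).realize_of_mem σ hσ
    · exact hcoll hφ
  · exact hS.choice hU ((Ultraproduct.sentence_realize _).2 (.of_forall fun _ => h))
  -- Truth goes up to the ultrapower and then, the parameters being constant germs, down to `N` by
  -- Łoś's theorem.
  · have h' := Part.realize_exBlock hS.below_of_mem hS.below_of_sub_below hφ _ h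
    exact Filter.eventually_const.1 ((realize_germ φ fun i _ => xs i).1 h')

/-- Each leading universal quantifier is removed by adding a counterexample to the tuple before the
new model is built, since that model depends on the tuple. -/
theorem exists_model_not_realize {N : Type} [LSet.Structure N] [Nonempty N] (hN : IsModel N)
    {n : ℕ} {φ : Fml n} (hφ : AllBlock (ExBlock IsDelta0P) n φ) (xs : Fin n → N)
    (h : ¬φ.Realize default xs) :
    ∃ (K : Type) (_ : LSet.Structure K) (ys : Fin n → K), Nonempty K ∧
      K ⊨ theoryM ∪ collection IsDelta0P ∧ (N ⊨ choiceAx → K ⊨ choiceAx) ∧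
      ¬φ.Realize default ys := by
  induction hφ with
  | base hφ =>
    obtain ⟨K, i, ys, hne, hK, hc, hφ'⟩ := hN.exists_collection_model xs
    exact ⟨K, i, ys, hne, hK, hc, fun hy => h (hφ' _ hφ hy)⟩
  | @all n φ _ ih =>
    rw [BoundedFormula.realize_all] at h
    push Not at h
    obtain ⟨x, hx⟩ := h
    obtain ⟨K, i, ys, hne, hK, hc, hy⟩ := ih _ hx
    refine ⟨K, i, fun j => ys j.castSucc, hne, hK, hc, fun hall => hy ?_⟩
    have h := BoundedFormula.realize_all.1 hall (ys (Fin.last n))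
    exact (Fin.snoc_init_self ys) ▸ h

-- From models back to provability

theorem Proves.mono {S T : LSet.Theory} (h : T ⊆ S) {φ : LSet.Sentence} (hφ : Proves T φ) :
    Proves S φ :=
  Derives.mono hφ (Set.image_mono h)

theorem Proves.sound {T : LSet.Theory} {φ : LSet.Sentence} (h : Proves T φ) {M : Type}
    [LSet.Structure M] [Nonempty M] (hM : M ⊨ T) : M ⊨ φ := by
  obtain ⟨x⟩ := ‹Nonempty M›
  refine (realize_ofSentence φ (fun _ => x) default).1 (Derives.sound h _ ?_)
  rintro _ ⟨ψ, hψ, rfl⟩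
  exact (realize_ofSentence ψ _ _).2 (hM.realize_of_mem ψ hψ)

/-- A theory between `M` and `Mac` whose axioms beyond `M` pass to the models constructed above. -/
theorem conservative_collection {T : LSet.Theory} (hT : theoryM ⊆ T)
    (hT' : T ⊆ theoryM ∪ {choiceAx}) :
    Conservative (IsPiP 2) (T ∪ collection IsDelta0P) T := by
  intro φ hφ
  refine ⟨fun h => ?_, Proves.mono Set.subset_union_left⟩
  by_contra hn
  obtain ⟨N, _, _, hN, hNφ⟩ := exists_model_of_not_proves hn
  have hNM : IsModel N := models_theoryM_iff.1 (hN.mono hT)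
  simp only [IsPiP, IsSigmaP] at hφ
  have hNφ' : ¬BoundedFormula.Realize φ (default : Empty → N) (default : Fin 0 → N) := hNφ
  obtain ⟨K, _, ys, _, hK, hc, hKφ⟩ := exists_model_not_realize hNM hφ _ hNφ'
  refine hKφ ?_
  have hKT : K ⊨ T ∪ collection IsDelta0P := by
    refine (Theory.model_iff _).2 ?_
    rintro σ (hσ | hσ)
    · rcases hT' hσ with hσM | rfl
      · exact hK.realize_of_mem σ (Or.inl hσM)
      · exact hc (hN.realize_of_mem _ hσ)
    · exact hK.realize_of_mem σ (Or.inr hσ)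
  have := h.sound hKT
  rw [Subsingleton.elim ys default]
  exact this

end SetTheories

theorem mainTheorem4 :
    SetTheories.Conservative (SetTheories.IsPiP 2)
        (SetTheories.theoryM ∪ SetTheories.collection SetTheories.IsDelta0P)
        SetTheories.theoryM ∧
      SetTheories.Conservative (SetTheories.IsPiP 2)
        (SetTheories.theoryMac ∪ SetTheories.collection SetTheories.IsDelta0P)
        SetTheories.theoryMac :=
  ⟨SetTheories.conservative_collection subset_rfl Set.subset_union_left,
    SetTheories.conservative_collection Set.subset_union_left subset_rfl⟩
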